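/- **Proposition 4.4.** Let $p$ be a prime and $n\ge 1$. Spaces are compactly generated, and maps and homotopies are pointed. Let $X=\Sigma X'$ be a $p$-local suspension, where $X'$ has the pointed homotopy type of a pointed CW complex; here $p$-local means that $X$ is simply connected and all its homotopy groups are $\mathbb Z_{(p)}$-modules. Let $X^{(n)}$ be the $n$-fold self smash product of $X$, on which $\Sigma_n$ acts by permuting positions, and use the suspension coordinate to add maps $X^{(n)}\to X^{(n)}$, so that every $\alpha=\sum_{\sigma}k_\sigma\sigma$ in the group ring $\mathbb Z_{(p)}(\Sigma_n)$ has a homotopy class $[\alpha]\in[X^{(n)},X^{(n)}]$, the unique class $c$ such that $Nc=\sum_\sigma (Nk_\sigma)[\sigma]$ for an integer $N$ prime to $p$ with all $Nk_\sigma\in\mathbb Z$. The smallest functorial retract $M_n(X)$ of $X^{(n)}$ is defined as follows. A functorial retract of the functor $V\mapsto V^{\otimes n}$ on $\mathbb Z_{(p)}$-modules is the image of a natural idempotent $\varepsilon_V\colon V^{\otimes n}\to V^{\otimes n}$; it contains the bottom cell if $\varepsilon_V(v\otimes\cdots\otimes v)=v\otimes\cdots\otimes v$ for all $V$ and all $v\in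 V$. Let $\varepsilon$ give a smallest functorial retract that contains the bottom cell, that is, one that contains the bottom cell while none of its proper functorial retracts does. Then $\varepsilon$ is given by the action, by permuting positions, of an element $e\in\mathbb Z_{(p)}(\Sigma_n)$, and $$M_n(X)=\operatorname{hocolim}_{e}X^{(n)}=\operatorname{hocolim}\bigl(X^{(n)}\xrightarrow{\,e\,}X^{(n)}\xrightarrow{\,e\,}X^{(n)}\to\cdots\bigr),$$ the reduced mapping telescope of a map $X^{(n)}\to X^{(n)}$ in the class $[e]$. Then the trace map $\phi_n=\sum_{\sigma\in\Sigma_n}\sigma\colon X^{(n)}\to X^{(n)}$ factors up to homotopy through $M_n(X)$: there is a map $b\colon M_n(X)\to X^{(n)}$ such that $\phi_n\simeq b\circ i$, where $i\colon X^{(n)}\to M_n(X)$ is the inclusion of the first term of the telescope. -/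

import Mathlib

noncomputable section

open scoped unitInterval TensorProduct

namespace LabelTrace

universe u v w

/-! ### Pointed spaces and pointed homotopy classes -/

/-- A chosen base point of a space. -/
class Based (X : Type u) where
  pt : X

/-- Base-point preserving continuous maps. -/
structure PMap (X : Type u) (Y : Type v) [TopologicalSpace X] [Based X]
    [TopologicalSpace Y] [Based Y] where
  toMap : C(X, Y)
  map_pt : toMap Based.pt = Based.pt

namespace PMap

variable {X : Type u} {Y : Type v} {Z : Type w} [TopologicalSpace X] [Based X]
  [TopologicalSpace Y] [Based Y] [TopologicalSpace Z] [Based Z]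

/-- The identity map. -/
def id (X : Type u) [TopologicalSpace X] [Based X] : PMap X X := ⟨ContinuousMap.id X, rfl⟩

/-- Composition `g ∘ f`. -/
def comp (g : PMap Y Z) (f : PMap X Y) : PMap X Z :=
  ⟨g.toMap.comp f.toMap, by simp [f.map_pt, g.map_pt]⟩

/-- The constant map to the base point. -/
def const (X : Type u) (Y : Type v) [TopologicalSpace X] [Based X]
    [TopologicalSpace Y] [Based Y] : PMap X Y := ⟨ContinuousMap.const X Based.pt, rfl⟩

/-- Pointed homotopy: a homotopy through base-point preserving maps. -/
def Homotopic (f g : PMap X Y) : Prop := f.toMap.HomotopicRel g.toMap {Based.pt}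

/-- Pointed homotopy is an equivalence relation. -/
instance homotopySetoid (X : Type u) (Y : Type v) [TopologicalSpace X] [Based X]
    [TopologicalSpace Y] [Based Y] : Setoid (PMap X Y) where
  r := Homotopic
  iseqv := ⟨fun f => .refl f.toMap, fun h => h.symm, fun h k => h.trans k⟩

theorem ext_apply {f g : PMap X Y} (h : ∀ x, f.toMap x = g.toMap x) : f = g := by
  cases f; cases g; congr; exact ContinuousMap.ext h

/-- A pointed homotopy, from a jointly continuous family of functions. -/
theorem homotopic_of_family (f g : PMap X Y) (H : I → X → Y)
    (hc : Continuous fun q : I × X => H q.1 q.2) (h0 : ∀ x, H 0 x = f.toMap x)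
    (h1 : ∀ x, H 1 x = g.toMap x) (hp : ∀ s, H s Based.pt = Based.pt) : f.Homotopic g :=
  ⟨{ toFun := fun q => H q.1 q.2
     continuous_toFun := hc
     map_zero_left := h0
     map_one_left := h1
     prop' := by
      rintro s x rfl
      exact (hp s).trans f.map_pt.symm }⟩

/-- A family of functions out of a pointed homotopy. -/
theorem Homotopic.family {f g : PMap X Y} (h : f.Homotopic g) : ∃ H : I → X → Y,
    (Continuous fun q : I × X => H q.1 q.2) ∧ (∀ x, H 0 x = f.toMap x) ∧
    (∀ x, H 1 x = g.toMap x) ∧ ∀ s, H s Based.pt = Based.pt := by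
  obtain ⟨F⟩ := h
  refine ⟨fun s x => F (s, x), F.continuous_toFun, fun x => F.apply_zero x, fun x => F.apply_one x,
    fun s => ?_⟩
  exact (F.eq_fst s (Set.mem_singleton _)).trans f.map_pt

end PMap

/-- The set `[X, Y]` of pointed homotopy classes of pointed maps. -/
def HClass (X : Type u) (Y : Type v) [TopologicalSpace X] [Based X]
    [TopologicalSpace Y] [Based Y] := Quotient (PMap.homotopySetoid X Y)

/-- The pointed homotopy class of a map. -/
def PMap.cls {X : Type u} {Y : Type v} [TopologicalSpace X] [Based X]
    [TopologicalSpace Y] [Based Y] (f : PMap X Y) : HClass X Y := Quotient.mk _ f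

/-- `X` has the pointed homotopy type of a CW complex having its base point as a vertex
(that is, of a CW complex relative to its base point). -/
def HasPointedCWType (X : Type u) [TopologicalSpace X] [Based X] : Prop :=
  ∃ (K : Type u) (_ : TopologicalSpace K) (_ : Based K) (_ : T2Space K)
    (_ : Topology.RelCWComplex (Set.univ : Set K) {(Based.pt : K)})
    (f : PMap X K) (g : PMap K X),
    (g.comp f).Homotopic (PMap.id X) ∧ (f.comp g).Homotopic (PMap.id K)

/-! ### Suspensions and smash powers -/

/-- The equivalence relation that collapses the set `S` to a point. -/
def collapse {Y : Type u} (S : Set Y) : Setoid Y where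
  r x y := x = y ∨ (x ∈ S ∧ y ∈ S)
  iseqv := by
    refine ⟨fun _ => .inl rfl, ?_, ?_⟩
    · rintro x y (rfl | ⟨h, k⟩)
      exacts [.inl rfl, .inr ⟨k, h⟩]
    · rintro x y z (rfl | ⟨h, k⟩) (rfl | ⟨h', k'⟩)
      exacts [.inl rfl, .inr ⟨h', k'⟩, .inr ⟨h, k⟩, .inr ⟨h, k'⟩]

/-- The part of `A × [0,1]` that is collapsed in the reduced suspension. -/
def suspBase (A : Type u) [Based A] : Set (A × I) :=
  {z | z.1 = Based.pt ∨ z.2 = 0 ∨ z.2 = 1}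

/-- The reduced suspension `ΣA`, with the quotient topology. -/
def Susp (A : Type u) [TopologicalSpace A] [Based A] : Type u :=
  Quotient (collapse (suspBase A))

section Susp

variable {A : Type u} [TopologicalSpace A] [Based A]

instance : TopologicalSpace (Susp A) :=
  inferInstanceAs (TopologicalSpace (Quotient (collapse (suspBase A))))

/-- The point `[a, t]` of the suspension. -/
def Susp.mk (a : A) (t : I) : Susp A := Quotient.mk (collapse (suspBase A)) (a, t)

instance : Based (Susp A) := ⟨Susp.mk Based.pt 0⟩

end Susp

/-- The `n`-fold product in the category of compactly generated spaces: the product topology is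
replaced by the final topology for all maps from compact Hausdorff spaces. -/
abbrev KProd (n : ℕ) (X : Type u) [TopologicalSpace X] : Type u :=
  Topology.WithGeneratedByTopology (fun K : CompHaus.{u} => (K : Type u)) (Fin n → X)

/-- The fat wedge. -/
def fatWedge (n : ℕ) (X : Type u) [TopologicalSpace X] [Based X] : Set (KProd n X) :=
  {x | ∃ i, Topology.WithGeneratedByTopology.equiv x i = Based.pt}

/-- The `n`-fold self smash product `X^{(n)}` (for `n ≥ 1`): the compactly generated `n`-fold
product with the fat wedge collapsed to the base point. -/
def Smash (n : ℕ) (X : Type u) [TopologicalSpace X] [Based X] : Type u :=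
  Quotient (collapse (fatWedge n X))

section Smash

variable {n : ℕ} {X : Type u} [TopologicalSpace X] [Based X]

instance : TopologicalSpace (Smash n X) :=
  inferInstanceAs (TopologicalSpace (Quotient (collapse (fatWedge n X))))

/-- The point `x₁ ∧ ⋯ ∧ xₙ`. -/
def Smash.mk (x : Fin n → X) : Smash n X :=
  Quotient.mk (collapse (fatWedge n X)) (Topology.WithGeneratedByTopology.equiv.symm x)

instance : Based (Smash n X) := ⟨Smash.mk fun _ => Based.pt⟩

end Smash

/-! ### Continuity criteria -/

section Continuity

theorem Susp.ind {A : Type u} [TopologicalSpace A] [Based A] {p : Susp A → Prop}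
    (h : ∀ a t, p (Susp.mk a t)) (z : Susp A) : p z :=
  Quotient.ind (fun q => h q.1 q.2) z

theorem Susp.mk_eq_iff {A : Type u} [TopologicalSpace A] [Based A] {a b : A} {s t : I} :
    Susp.mk a s = Susp.mk b t ↔ (a = b ∧ s = t) ∨ ((a = Based.pt ∨ s = 0 ∨ s = 1) ∧
      (b = Based.pt ∨ t = 0 ∨ t = 1)) := by
  refine (Quotient.eq (r := collapse (suspBase A))).trans ?_
  change ((a, s) = (b, t) ∨ _) ↔ _
  rw [Prod.mk.injEq]
  exact Iff.rfl

theorem Susp.mk_eq_pt {A : Type u} [TopologicalSpace A] [Based A] {a : A} {s : I} :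
    Susp.mk a s = Based.pt ↔ (a = Based.pt ∨ s = 0 ∨ s = 1) := by
  change Susp.mk a s = Susp.mk _ _ ↔ _
  rw [Susp.mk_eq_iff]
  simp only [true_or, or_true, and_true]
  constructor
  · rintro (⟨h, -⟩ | h)
    exacts [.inl h, h]
  · exact .inr

theorem Susp.continuous_mk {A : Type u} [TopologicalSpace A] [Based A] :
    Continuous fun q : A × I => Susp.mk q.1 q.2 :=
  continuous_quotient_mk'

theorem Smash.ind {n : ℕ} {X : Type u} [TopologicalSpace X] [Based X] {p : Smash n X → Prop}
    (h : ∀ x, p (Smash.mk x)) (z : Smash n X) : p z :=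
  Quotient.ind (fun q => h q) z

theorem Smash.mk_eq_pt {n : ℕ} {X : Type u} [TopologicalSpace X] [Based X] {x : Fin n → X}
    {i : Fin n} (h : x i = Based.pt) : Smash.mk x = Based.pt :=
  Quotient.sound (.inr ⟨⟨i, h⟩, ⟨i, rfl⟩⟩)

/-- A function out of `X^{(n)}` from a function on the product. -/
def Smash.lift {n : ℕ} {X : Type u} [TopologicalSpace X] [Based X] {Z : Type v}
    (F : (Fin n → X) → Z) (z₀ : Z) (h : ∀ x, (∃ i, x i = Based.pt) → F x = z₀) :
    Smash n X → Z :=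
  Quotient.lift (fun x => F (Topology.WithGeneratedByTopology.equiv x)) (by
    rintro x y (rfl | ⟨hx, hy⟩)
    · rfl
    · rw [h _ hx, h _ hy])

@[simp] theorem Smash.lift_mk {n : ℕ} {X : Type u} [TopologicalSpace X] [Based X] {Z : Type v}
    (F : (Fin n → X) → Z) (z₀ : Z) (h) (x : Fin n → X) :
    Smash.lift F z₀ h (Smash.mk x) = F x := rfl

theorem Smash.continuous_iff {n : ℕ} {X : Type u} [TopologicalSpace X] [Based X] {Z : Type v}
    [TopologicalSpace Z] (F : Smash n X → Z) : Continuous F ↔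
      ∀ (K : CompHaus.{u}) (f : C(K, Fin n → X)), Continuous fun k => F (Smash.mk (f k)) := by
  have hq : Topology.IsQuotientMap (Quotient.mk (collapse (fatWedge n X))) := isQuotientMap_quotient_mk'
  refine hq.continuous_iff.trans ?_
  exact Topology.WithGeneratedByTopology.continuous_from_iff _

theorem Smash.continuous_mk_comp {n : ℕ} {X : Type u} [TopologicalSpace X] [Based X]
    {K : Type u} [TopologicalSpace K] [CompactSpace K] [T2Space K] (f : C(K, Fin n → X)) :
    Continuous fun k => (Smash.mk (f k) : Smash n X) :=
  (Smash.continuous_iff id).1 continuous_id (CompHaus.of K) f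

/-- Joint continuity with a locally compact parameter space. -/
theorem Smash.continuous_param {n : ℕ} {X : Type u} [TopologicalSpace X] [Based X] {Z : Type v}
    [TopologicalSpace Z] {P : Type w} [TopologicalSpace P] [LocallyCompactSpace P]
    (F : P → Smash n X → Z)
    (h : ∀ (K : CompHaus.{u}) (f : C(K, Fin n → X)),
      Continuous fun q : P × K => F q.1 (Smash.mk (f q.2))) :
    Continuous fun q : P × Smash n X => F q.1 q.2 := by
  have h1 : ∀ z, Continuous fun p => F p z := Smash.ind fun x => by
    have := h (CompHaus.of PUnit) (ContinuousMap.const _ x)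
    exact this.comp (by fun_prop : Continuous fun p : P => (p, PUnit.unit))
  let G : Smash n X → C(P, Z) := fun z => ⟨fun p => F p z, h1 z⟩
  have hG : Continuous G := by
    rw [Smash.continuous_iff]
    intro K f
    refine ContinuousMap.continuous_of_continuous_uncurry _ ?_
    exact (h K f).comp continuous_swap
  have := ContinuousMap.continuous_uncurry_of_continuous ⟨G, hG⟩
  exact this.comp continuous_swap

theorem Susp.continuous_param {A : Type u} [TopologicalSpace A] [Based A] {Z : Type v}
    [TopologicalSpace Z] {P : Type w} [TopologicalSpace P] [LocallyCompactSpace P]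
    (F : P → Susp A → Z)
    (h : Continuous fun q : P × (A × I) => F q.1 (Susp.mk q.2.1 q.2.2)) :
    Continuous fun q : P × Susp A => F q.1 q.2 := by
  have h1 : ∀ z, Continuous fun p => F p z := Susp.ind fun a t =>
    h.comp (by fun_prop : Continuous fun p : P => (p, (a, t)))
  let G : Susp A → C(P, Z) := fun z => ⟨fun p => F p z, h1 z⟩
  have hG : Continuous G := by
    have hq : Topology.IsQuotientMap (Quotient.mk (collapse (suspBase A))) := isQuotientMap_quotient_mk'
    refine hq.continuous_iff.2 (ContinuousMap.continuous_of_continuous_uncurry _ ?_)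
    exact h.comp continuous_swap
  have := ContinuousMap.continuous_uncurry_of_continuous ⟨G, hG⟩
  exact this.comp continuous_swap

end Continuity

/-! ### The group structure on `[(ΣA)^{(n)}, W]` -/

section Reparam

/-- `θ` maps the end points of the unit interval to end points. -/
def EndPres (θ : I → I) : Prop := (θ 0 = 0 ∨ θ 0 = 1) ∧ (θ 1 = 0 ∨ θ 1 = 1)

variable {A : Type u} [TopologicalSpace A] [Based A]

/-- The map `[a, t] ↦ [a, θ t]` of the suspension. -/
def Susp.reparam (θ : I → I) (h : EndPres θ) : Susp A → Susp A :=
  Quotient.lift (fun q : A × I => Susp.mk q.1 (θ q.2)) (by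
    have key : ∀ q : A × I, q ∈ suspBase A → Susp.mk q.1 (θ q.2) = Based.pt := by
      rintro ⟨a, t⟩ (h' | h' | h')
      · exact Susp.mk_eq_pt.2 (.inl h')
      · dsimp only at h'
        subst h'
        exact Susp.mk_eq_pt.2 (.inr h.1)
      · dsimp only at h'
        subst h'
        exact Susp.mk_eq_pt.2 (.inr h.2)
    rintro x y (rfl | ⟨hx, hy⟩)
    · rfl
    · rw [key x hx, key y hy])

@[simp] theorem Susp.reparam_mk (θ : I → I) (h : EndPres θ) (a : A) (t : I) :
    Susp.reparam θ h (Susp.mk a t) = Susp.mk a (θ t) := rfl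

theorem Susp.reparam_pt (θ : I → I) (h : EndPres θ) :
    Susp.reparam θ h (Based.pt : Susp A) = Based.pt :=
  Susp.mk_eq_pt.2 (.inl rfl)

theorem Susp.continuous_reparam {P : Type w} [TopologicalSpace P] [LocallyCompactSpace P]
    (θ : P → I → I) (h : ∀ p, EndPres (θ p)) (hc : Continuous fun q : P × I => θ q.1 q.2) :
    Continuous fun q : P × Susp A => Susp.reparam (θ q.1) (h q.1) q.2 := by
  refine Susp.continuous_param (fun p z => Susp.reparam (θ p) (h p) z) ?_
  have : Continuous fun q : P × (A × I) => (q.2.1, θ q.1 q.2.2) :=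
    (by fun_prop : Continuous fun q : P × (A × I) => q.2.1).prodMk
      (hc.comp (by fun_prop : Continuous fun q : P × (A × I) => (q.1, q.2.2)))
  exact Susp.continuous_mk.comp this

/-- `t ↦ 2t`, cut off at `1`. -/
def low (t : I) : I := Set.projIcc 0 1 zero_le_one (2 * (t : ℝ))

/-- `t ↦ 2t - 1`, cut off at `0`. -/
def high (t : I) : I := Set.projIcc 0 1 zero_le_one (2 * (t : ℝ) - 1)

theorem continuous_low : Continuous low := by unfold low; fun_prop

theorem continuous_high : Continuous high := by unfold high; fun_prop

theorem coe_low (t : I) : (low t : ℝ) = min 1 (2 * (t : ℝ)) := by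
  have := t.2.1
  simp [low, Set.coe_projIcc, this]

theorem coe_high (t : I) : (high t : ℝ) = max 0 (2 * (t : ℝ) - 1) := by
  have := t.2.2
  rw [high, Set.coe_projIcc, min_eq_right (by linarith)]

theorem low_eq_one {t : I} (h : 1 / 2 ≤ (t : ℝ)) : low t = 1 :=
  Subtype.ext (by rw [coe_low, min_eq_left (by linarith)]; rfl)

theorem high_eq_zero {t : I} (h : (t : ℝ) ≤ 1 / 2) : high t = 0 :=
  Subtype.ext (by rw [coe_high, max_eq_left (by linarith)]; rfl)

theorem low_endPres : EndPres low :=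
  ⟨.inl (Subtype.ext (by rw [coe_low]; simp)), .inr (low_eq_one (by norm_num))⟩

theorem high_endPres : EndPres high :=
  ⟨.inl (high_eq_zero (by norm_num)), .inr (Subtype.ext (by rw [coe_high]; norm_num))⟩

theorem symm_endPres : EndPres unitInterval.symm := by simp [EndPres]

end Reparam

section Coord

variable {n : ℕ} {X : Type u} [TopologicalSpace X] [Based X]

/-- Apply a base-point preserving function in the `i`-th smash factor. -/
def Smash.onCoord (i : Fin n) (u : X → X) (hu : u Based.pt = Based.pt) :
    Smash n X → Smash n X :=
  Smash.lift (fun x => Smash.mk (Function.update x i (u (x i)))) Based.pt (by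
    rintro x ⟨j, hj⟩
    refine Smash.mk_eq_pt (i := j) ?_
    by_cases h : j = i
    · subst h; simp [hj, hu]
    · rw [Function.update_of_ne h, hj])

@[simp] theorem Smash.onCoord_mk (i : Fin n) (u : X → X) (hu) (x : Fin n → X) :
    Smash.onCoord i u hu (Smash.mk x) = Smash.mk (Function.update x i (u (x i))) := rfl

theorem Smash.onCoord_pt (i : Fin n) (u : X → X) (hu) :
    Smash.onCoord i u hu (Based.pt : Smash n X) = Based.pt :=
  Smash.mk_eq_pt (i := i) (by simp [hu])

theorem Smash.continuous_onCoord {P : Type} [TopologicalSpace P] [CompactSpace P] [T2Space P]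
    (i : Fin n) (u : P → X → X) (hu : ∀ p, u p Based.pt = Based.pt)
    (hc : Continuous fun q : P × X => u q.1 q.2) :
    Continuous fun q : P × Smash n X => Smash.onCoord i (u q.1) (hu q.1) q.2 := by
  refine Smash.continuous_param (fun p z => Smash.onCoord i (u p) (hu p) z) fun K f => ?_
  have : Continuous fun q : P × K => Function.update (f q.2) i (u q.1 (f q.2 i)) := by
    refine Continuous.update (by fun_prop) i ?_
    exact hc.comp (by fun_prop : Continuous fun q : P × K => (q.1, f q.2 i))
  exact Smash.continuous_mk_comp ⟨_, this⟩

end Coord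

section Add

variable {n : ℕ} {A : Type u} [TopologicalSpace A] [Based A] {W : Type v} [TopologicalSpace W]
  [Based W]

/-- The self map of `(ΣA)^{(n)}` that applies `θ` to the `i`-th suspension coordinate. -/
def PMap.reparam (i : Fin n) (θ : I → I) (h : EndPres θ) (hc : Continuous θ) :
    PMap (Smash n (Susp A)) (Smash n (Susp A)) where
  toMap := ⟨fun z => Smash.onCoord i (Susp.reparam θ h) (Susp.reparam_pt θ h) z, by
    have := Smash.continuous_onCoord (n := n) (X := Susp A) (P := Unit) i
      (fun _ => Susp.reparam θ h) (fun _ => Susp.reparam_pt θ h)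
      (Susp.continuous_reparam (fun _ => θ) (fun _ => h) (by fun_prop))
    exact this.comp (by fun_prop : Continuous fun z : Smash n (Susp A) => ((), z))⟩
  map_pt := Smash.onCoord_pt i (Susp.reparam θ h) (Susp.reparam_pt θ h)

theorem PMap.reparam_mk (i : Fin n) (θ : I → I) (h : EndPres θ) (hc : Continuous θ)
    (x : Fin n → Susp A) : (PMap.reparam i θ h hc).toMap (Smash.mk x) =
      Smash.mk (Function.update x i (Susp.reparam θ h (x i))) := rfl

/-- Reparametrizations that agree at the end points are homotopic. -/
theorem PMap.reparam_homotopic (i : Fin n) {θ θ' : I → I} (h : EndPres θ) (hc : Continuous θ)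
    (h' : EndPres θ') (hc' : Continuous θ') (e0 : θ 0 = θ' 0) (e1 : θ 1 = θ' 1) :
    (PMap.reparam (A := A) i θ h hc).Homotopic (PMap.reparam i θ' h' hc') := by
  let H : I → I → I := fun s t => ⟨(1 - (s : ℝ)) * θ t + s * θ' t, by
    have a := s.2; have b := (θ t).2; have c := (θ' t).2
    simp only [Set.mem_Icc] at a b c ⊢
    constructor <;> nlinarith⟩
  have e : ∀ s t, θ t = θ' t → H s t = θ t := fun s t ht => Subtype.ext (by
    simp only [H, ← ht]; ring)
  have hE : ∀ s, EndPres (H s) := fun s => by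
    unfold EndPres
    rw [e s 0 e0, e s 1 e1]
    exact h
  have hH : Continuous fun q : I × I => H q.1 q.2 := by
    refine Continuous.subtype_mk ?_ _
    fun_prop
  have hz : ∀ t, H 0 t = θ t := fun t => Subtype.ext (by simp [H])
  have ho : ∀ t, H 1 t = θ' t := fun t => Subtype.ext (by simp [H])
  refine PMap.homotopic_of_family _ _ (fun s => Smash.onCoord i (Susp.reparam (H s) (hE s))
    (Susp.reparam_pt _ _)) ?_ ?_ ?_ (fun s => Smash.onCoord_pt _ _ _)
  · exact Smash.continuous_onCoord i (fun s => Susp.reparam (H s) (hE s))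
      (fun s => Susp.reparam_pt _ _) (Susp.continuous_reparam H hE hH)
  · have e0 : H 0 = θ := funext hz
    have : ∀ η (hη : EndPres η), η = θ → ∀ x : Smash n (Susp A),
        Smash.onCoord i (Susp.reparam η hη) (Susp.reparam_pt _ _) x =
          (PMap.reparam i θ h hc).toMap x := by
      rintro η hη rfl x
      rfl
    exact this _ _ e0
  · have e1 : H 1 = θ' := funext ho
    have : ∀ η (hη : EndPres η), η = θ' → ∀ x : Smash n (Susp A),
        Smash.onCoord i (Susp.reparam η hη) (Susp.reparam_pt _ _) x =
          (PMap.reparam i θ' h' hc').toMap x := by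
      rintro η hη rfl x
      rfl
    exact this _ _ e1

/-- The lower half `{[a, t] | t ≤ 1/2}` of the suspension. -/
def Susp.lowHalf (A : Type u) [TopologicalSpace A] [Based A] : Set (Susp A) :=
  {z | ∃ (a : A) (t : I), (t : ℝ) ≤ 1 / 2 ∧ z = Susp.mk a t}

/-- The upper half `{[a, t] | 1/2 ≤ t}` of the suspension. -/
def Susp.highHalf (A : Type u) [TopologicalSpace A] [Based A] : Set (Susp A) :=
  {z | ∃ (a : A) (t : I), 1 / 2 ≤ (t : ℝ) ∧ z = Susp.mk a t}

theorem Susp.mk_mem_lowHalf {a : A} {t : I} :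
    Susp.mk a t ∈ Susp.lowHalf A ↔ (t : ℝ) ≤ 1 / 2 ∨ a = Based.pt ∨ t = 1 := by
  constructor
  · rintro ⟨b, s, hs, h⟩
    rcases Susp.mk_eq_iff.1 h with ⟨-, rfl⟩ | ⟨h1 | h1 | h1, -⟩
    · exact .inl hs
    · exact .inr (.inl h1)
    · left; rw [h1]; norm_num
    · exact .inr (.inr h1)
  · intro h
    by_cases ht : (t : ℝ) ≤ 1 / 2
    · exact ⟨a, t, ht, rfl⟩
    · refine ⟨Based.pt, 0, by norm_num, ?_⟩
      exact Susp.mk_eq_iff.2 (.inr ⟨(h.resolve_left ht).imp_right .inr, .inl rfl⟩)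

theorem Susp.mk_mem_highHalf {a : A} {t : I} :
    Susp.mk a t ∈ Susp.highHalf A ↔ 1 / 2 ≤ (t : ℝ) ∨ a = Based.pt ∨ t = 0 := by
  constructor
  · rintro ⟨b, s, hs, h⟩
    rcases Susp.mk_eq_iff.1 h with ⟨-, rfl⟩ | ⟨h1 | h1 | h1, -⟩
    · exact .inl hs
    · exact .inr (.inl h1)
    · exact .inr (.inr h1)
    · left; rw [h1]; norm_num
  · intro h
    by_cases ht : 1 / 2 ≤ (t : ℝ)
    · exact ⟨a, t, ht, rfl⟩
    · refine ⟨Based.pt, 1, by norm_num, ?_⟩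
      exact Susp.mk_eq_iff.2 (.inr ⟨(h.resolve_left ht).imp_right .inl, .inl rfl⟩)

theorem Susp.isClosed_lowHalf [T1Space A] : IsClosed (Susp.lowHalf A) := by
  have hq : Topology.IsQuotientMap (Quotient.mk (collapse (suspBase A))) :=
    isQuotientMap_quotient_mk'
  refine hq.isClosed_preimage.1 ?_
  have : Quotient.mk (collapse (suspBase A)) ⁻¹' Susp.lowHalf A =
      {q : A × I | (q.2 : ℝ) ≤ 1 / 2} ∪ ({q | q.1 = Based.pt} ∪ {q | q.2 = 1}) :=
    Set.ext fun q => Susp.mk_mem_lowHalf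
  rw [this]
  exact (isClosed_le (by fun_prop) (by fun_prop)).union
    ((isClosed_singleton.preimage continuous_fst).union
      (isClosed_eq continuous_snd continuous_const))

theorem Susp.isClosed_highHalf [T1Space A] : IsClosed (Susp.highHalf A) := by
  have hq : Topology.IsQuotientMap (Quotient.mk (collapse (suspBase A))) :=
    isQuotientMap_quotient_mk'
  refine hq.isClosed_preimage.1 ?_
  have : Quotient.mk (collapse (suspBase A)) ⁻¹' Susp.highHalf A =
      {q : A × I | 1 / 2 ≤ (q.2 : ℝ)} ∪ ({q | q.1 = Based.pt} ∪ {q | q.2 = 0}) :=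
    Set.ext fun q => Susp.mk_mem_highHalf
  rw [this]
  exact (isClosed_le (by fun_prop) (by fun_prop)).union
    ((isClosed_singleton.preimage continuous_fst).union
      (isClosed_eq continuous_snd continuous_const))

theorem Susp.lowHalf_or_highHalf (z : Susp A) : z ∈ Susp.lowHalf A ∨ z ∈ Susp.highHalf A := by
  induction z using Susp.ind with
  | h a t => exact (le_total (t : ℝ) (1 / 2)).imp (fun h => ⟨a, t, h, rfl⟩) fun h => ⟨a, t, h, rfl⟩

open Classical in
/-- The co-`H` sum of two functions on `(ΣA)^{(n)}`, formed with the `i`-th suspension coordinate: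
`F` is used, at double speed, on the lower half and `G` on the upper half. See `addFun_mk` for
the formula. -/
def addFun (i : Fin n) (F G : Smash n (Susp A) → W) (hF : F Based.pt = Based.pt)
    (hG : G Based.pt = Based.pt) : Smash n (Susp A) → W :=
  Smash.lift (fun x => if x i ∈ Susp.lowHalf A
      then F (Smash.mk (Function.update x i (Susp.reparam low low_endPres (x i))))
      else G (Smash.mk (Function.update x i (Susp.reparam high high_endPres (x i)))))
    Based.pt (by
      rintro x ⟨j, hj⟩
      have key : ∀ θ h, (Smash.mk (Function.update x i (Susp.reparam θ h (x i))) :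
          Smash n (Susp A)) = Based.pt := fun θ h => by
        change Smash.onCoord i (Susp.reparam θ h) (Susp.reparam_pt θ h) (Smash.mk x) = _
        rw [Smash.mk_eq_pt hj, Smash.onCoord_pt]
      rw [key, key, hF, hG, ite_self])

theorem addFun_mk (i : Fin n) (F G : Smash n (Susp A) → W) (hF : F Based.pt = Based.pt)
    (hG : G Based.pt = Based.pt) (x : Fin n → Susp A) (a : A) (t : I) (hx : x i = Susp.mk a t) :
    addFun i F G hF hG (Smash.mk x) = if (t : ℝ) ≤ 1 / 2
      then F (Smash.mk (Function.update x i (Susp.mk a (low t))))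
      else G (Smash.mk (Function.update x i (Susp.mk a (high t)))) := by
  classical
  have hb : ∀ z : Susp A, z = Based.pt → (Smash.mk (Function.update x i z) : Smash n (Susp A)) =
      Based.pt := fun z hz => Smash.mk_eq_pt (i := i) (by simp [hz])
  unfold addFun
  rw [Smash.lift_mk]
  simp only [hx, Susp.reparam_mk, Susp.mk_mem_lowHalf]
  by_cases ht : (t : ℝ) ≤ 1 / 2
  · rw [if_pos (.inl ht), if_pos ht]
  · by_cases hp : a = Based.pt ∨ t = 1
    · rw [if_pos (.inr hp), if_neg ht, hb, hb, hF, hG]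
      · rcases hp with rfl | rfl
        · exact Susp.mk_eq_pt.2 (.inl rfl)
        · exact Susp.mk_eq_pt.2 (.inr high_endPres.2)
      · rcases hp with rfl | rfl
        · exact Susp.mk_eq_pt.2 (.inl rfl)
        · exact Susp.mk_eq_pt.2 (.inr low_endPres.2)
    · rw [if_neg (by tauto), if_neg ht]

theorem addFun_pt (i : Fin n) (F G : Smash n (Susp A) → W) (hF : F Based.pt = Based.pt)
    (hG : G Based.pt = Based.pt) : addFun i F G hF hG Based.pt = Based.pt := by
  have : (Smash.mk fun _ => (Based.pt : Susp A) : Smash n (Susp A)) = Based.pt := rfl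
  rw [← this, addFun_mk i F G hF hG _ Based.pt 0 rfl, if_pos (by norm_num),
    Smash.mk_eq_pt (i := i) (by simpa using Susp.mk_eq_pt.2 (.inl rfl)), hF]

theorem continuous_addFun [T1Space A] {P : Type} [TopologicalSpace P] [CompactSpace P] [T2Space P]
    (i : Fin n) (F G : P → Smash n (Susp A) → W) (hF : ∀ p, F p Based.pt = Based.pt)
    (hG : ∀ p, G p Based.pt = Based.pt) (cF : Continuous fun q : P × Smash n (Susp A) => F q.1 q.2)
    (cG : Continuous fun q : P × Smash n (Susp A) => G q.1 q.2) :
    Continuous fun q : P × Smash n (Susp A) => addFun i (F q.1) (G q.1) (hF q.1) (hG q.1) q.2 := by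
  classical
  refine Smash.continuous_param (fun p z => addFun i (F p) (G p) (hF p) (hG p) z) fun K f => ?_
  have hm : ∀ θ (h : EndPres θ), Continuous θ → Continuous fun q : P × K =>
      (Smash.mk (Function.update (f q.2) i (Susp.reparam θ h (f q.2 i))) : Smash n (Susp A)) := by
    intro θ h hc
    have h2 : Continuous fun q : P × K => (Smash.mk (f q.2) : Smash n (Susp A)) :=
      (Smash.continuous_mk_comp f).comp continuous_snd
    exact (PMap.reparam i θ h hc).toMap.continuous.comp h2
  have ev : Continuous fun q : P × K => f q.2 i := by fun_prop
  refine Continuous.if (p := fun q : P × K => f q.2 i ∈ Susp.lowHalf A) ?_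
    (cF.comp (continuous_fst.prodMk (hm low low_endPres continuous_low)))
    (cG.comp (continuous_fst.prodMk (hm high high_endPres continuous_high)))
  intro q hq
  have hl : f q.2 i ∈ Susp.lowHalf A :=
    (Susp.isClosed_lowHalf.preimage ev).frontier_subset hq
  have hh : f q.2 i ∈ Susp.highHalf A := by
    rw [← frontier_compl] at hq
    refine (closure_minimal (t := (fun q : P × K => f q.2 i) ⁻¹' Susp.highHalf A) ?_
      (Susp.isClosed_highHalf.preimage ev)) (frontier_subset_closure hq)
    exact fun q hq => (Susp.lowHalf_or_highHalf _).resolve_left hq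
  have hb : ∀ z : Susp A, z = Based.pt →
      (Smash.mk (Function.update (f q.2) i z) : Smash n (Susp A)) =
      Based.pt := fun z hz => Smash.mk_eq_pt (i := i) (by simp [hz])
  change F q.1 (Smash.mk (Function.update (f q.2) i (Susp.reparam low low_endPres (f q.2 i)))) =
    G q.1 (Smash.mk (Function.update (f q.2) i (Susp.reparam high high_endPres (f q.2 i))))
  rw [hb, hb, hF, hG]
  all_goals
    revert hl hh
    generalize f q.2 i = z
    induction z using Susp.ind with
    | h a t =>
      rw [Susp.mk_mem_lowHalf, Susp.mk_mem_highHalf, Susp.reparam_mk, Susp.mk_eq_pt]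
      rintro (h1 | rfl | rfl) (h2 | h2 | h2)
      all_goals try subst h2
      all_goals first
        | exact absurd h2 one_ne_zero
        | exact .inl rfl
        | exact .inl h2
        | exact .inr low_endPres.1
        | exact .inr low_endPres.2
        | exact .inr high_endPres.1
        | exact .inr high_endPres.2
        | exact .inr (.inr (low_eq_one h2))
        | exact .inr (.inl (high_eq_zero h1))

/-- The sum of two maps `(ΣA)^{(n)} → W`, formed with the `i`-th suspension coordinate. -/
def PMap.addAt [T1Space A] (i : Fin n) (f g : PMap (Smash n (Susp A)) W) :
    PMap (Smash n (Susp A)) W where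
  toMap := ⟨fun z => addFun i f.toMap g.toMap f.map_pt g.map_pt z, by
    have := continuous_addFun (P := Unit) i (fun _ => f.toMap) (fun _ => g.toMap)
      (fun _ => f.map_pt) (fun _ => g.map_pt) (by fun_prop) (by fun_prop)
    exact this.comp (by fun_prop : Continuous fun z : Smash n (Susp A) => ((), z))⟩
  map_pt := addFun_pt i f.toMap g.toMap f.map_pt g.map_pt

theorem PMap.addAt_mk [T1Space A] (i : Fin n) (f g : PMap (Smash n (Susp A)) W)
    (x : Fin n → Susp A) (a : A) (t : I) (hx : x i = Susp.mk a t) :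
    (PMap.addAt i f g).toMap (Smash.mk x) = if (t : ℝ) ≤ 1 / 2
      then f.toMap (Smash.mk (Function.update x i (Susp.mk a (low t))))
      else g.toMap (Smash.mk (Function.update x i (Susp.mk a (high t)))) :=
  addFun_mk i f.toMap g.toMap f.map_pt g.map_pt x a t hx

theorem PMap.addAt_homotopic [T1Space A] (i : Fin n) {f f' g g' : PMap (Smash n (Susp A)) W}
    (hf : f.Homotopic f') (hg : g.Homotopic g') :
    (PMap.addAt i f g).Homotopic (PMap.addAt i f' g') := by
  obtain ⟨F, cF, F0, F1, Fp⟩ := hf.family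
  obtain ⟨G, cG, G0, G1, Gp⟩ := hg.family
  refine PMap.homotopic_of_family _ _ (fun s => addFun i (F s) (G s) (Fp s) (Gp s))
    (continuous_addFun i F G Fp Gp cF cG) ?_ ?_ (fun s => addFun_pt _ _ _ _ _)
  · have a : F 0 = f.toMap := funext F0
    have b : G 0 = g.toMap := funext G0
    have : ∀ (F G : Smash n (Susp A) → W) (hF : F Based.pt = Based.pt)
        (hG : G Based.pt = Based.pt), F = f.toMap → G = g.toMap →
        ∀ x, addFun i F G hF hG x = (PMap.addAt i f g).toMap x := by
      rintro _ _ hF hG rfl rfl x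
      rfl
    exact this _ _ _ _ a b
  · have a : F 1 = f'.toMap := funext F1
    have b : G 1 = g'.toMap := funext G1
    have : ∀ (F G : Smash n (Susp A) → W) (hF : F Based.pt = Based.pt)
        (hG : G Based.pt = Based.pt), F = f'.toMap → G = g'.toMap →
        ∀ x, addFun i F G hF hG x = (PMap.addAt i f' g').toMap x := by
      rintro _ _ hF hG rfl rfl x
      rfl
    exact this _ _ _ _ a b

/-- The inverse of a map `(ΣA)^{(n)} → W`: the `i`-th suspension coordinate is reversed. -/
def PMap.negAt (i : Fin n) (f : PMap (Smash n (Susp A)) W) : PMap (Smash n (Susp A)) W :=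
  f.comp (PMap.reparam i unitInterval.symm symm_endPres unitInterval.continuous_symm)

theorem PMap.comp_homotopic {X : Type u} {Y : Type v} {Z : Type w} [TopologicalSpace X] [Based X]
    [TopologicalSpace Y] [Based Y] [TopologicalSpace Z] [Based Z] {g g' : PMap Y Z}
    {f f' : PMap X Y} (hg : g.Homotopic g') (hf : f.Homotopic f') :
    (g.comp f).Homotopic (g'.comp f') := by
  obtain ⟨F, cF, F0, F1, Fp⟩ := hf.family
  obtain ⟨G, cG, G0, G1, Gp⟩ := hg.family
  refine PMap.homotopic_of_family _ _ (fun s x => G s (F s x)) ?_ ?_ ?_ ?_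
  · exact cG.comp (continuous_fst.prodMk cF)
  · intro x; rw [F0, G0]; rfl
  · intro x; rw [F1, G1]; rfl
  · intro s; rw [Fp, Gp]

theorem PMap.comp_reparam_homotopic (f : PMap (Smash n (Susp A)) W)
    (i : Fin n) {θ θ' : I → I} (h : EndPres θ) (hc : Continuous θ)
    (h' : EndPres θ') (hc' : Continuous θ') (e0 : θ 0 = θ' 0) (e1 : θ 1 = θ' 1) :
    (f.comp (PMap.reparam i θ h hc)).Homotopic (f.comp (PMap.reparam i θ' h' hc')) :=
  PMap.comp_homotopic (.refl _) (PMap.reparam_homotopic i h hc h' hc' e0 e1)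

theorem PMap.comp_reparam_mk (f : PMap (Smash n (Susp A)) W) (i : Fin n) {θ : I → I}
    (h : EndPres θ) (hc : Continuous θ) (x : Fin n → Susp A) (a : A) (t : I)
    (hx : x i = Susp.mk a t) : (f.comp (PMap.reparam i θ h hc)).toMap (Smash.mk x) =
      f.toMap (Smash.mk (Function.update x i (Susp.mk a (θ t)))) := by
  change f.toMap ((PMap.reparam i θ h hc).toMap (Smash.mk x)) = _
  rw [PMap.reparam_mk, hx, Susp.reparam_mk]

theorem id_endPres : EndPres (fun t => t) := by simp [EndPres]

theorem PMap.comp_reparam_id (f : PMap (Smash n (Susp A)) W) (i : Fin n) :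
    f.comp (PMap.reparam i (fun t => t) id_endPres continuous_id) = f := by
  refine PMap.ext_apply (Smash.ind fun x => ?_)
  obtain ⟨⟨a, t⟩, h⟩ := Quotient.exists_rep (x i)
  rw [PMap.comp_reparam_mk f i _ _ x a t h.symm]
  congr 2
  exact Function.update_eq_self_iff.2 h

theorem mk_update_pt (i : Fin n) (x : Fin n → Susp A) {z : Susp A} (h : z = Based.pt) :
    (Smash.mk (Function.update x i z) : Smash n (Susp A)) = Based.pt :=
  Smash.mk_eq_pt (i := i) (by simp [h])

/-- Two maps agree if they agree on points with given `i`-th suspension coordinate. -/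
theorem PMap.ext_coord (i : Fin n) {f g : PMap (Smash n (Susp A)) W}
    (h : ∀ (x : Fin n → Susp A) a t, x i = Susp.mk a t →
      f.toMap (Smash.mk x) = g.toMap (Smash.mk x)) : f = g := by
  refine PMap.ext_apply (Smash.ind fun x => ?_)
  obtain ⟨⟨a, t⟩, e⟩ := Quotient.exists_rep (x i)
  exact h x a t e.symm

theorem PMap.zero_addAt [T1Space A] (i : Fin n) (f : PMap (Smash n (Susp A)) W) :
    (PMap.addAt i (PMap.const _ _) f).Homotopic f := by
  have e : PMap.addAt i (PMap.const _ _) f =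
      f.comp (PMap.reparam i high high_endPres continuous_high) := by
    refine PMap.ext_coord i fun x a t hx => ?_
    rw [PMap.addAt_mk i _ _ x a t hx, PMap.comp_reparam_mk f i _ _ x a t hx]
    split_ifs with h
    · rw [high_eq_zero h, mk_update_pt i x (Susp.mk_eq_pt.2 (.inr (.inl rfl))), f.map_pt]
      rfl
    · rfl
  rw [e]
  conv => rhs; rw [← PMap.comp_reparam_id f i]
  exact PMap.comp_reparam_homotopic f i _ _ _ _ (high_eq_zero (by norm_num))
    (Subtype.ext (by rw [coe_high]; norm_num))

theorem PMap.addAt_zero [T1Space A] (i : Fin n) (f : PMap (Smash n (Susp A)) W) :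
    (PMap.addAt i f (PMap.const _ _)).Homotopic f := by
  have e : PMap.addAt i f (PMap.const _ _) =
      f.comp (PMap.reparam i low low_endPres continuous_low) := by
    refine PMap.ext_coord i fun x a t hx => ?_
    rw [PMap.addAt_mk i _ _ x a t hx, PMap.comp_reparam_mk f i _ _ x a t hx]
    split_ifs with h
    · rfl
    · rw [low_eq_one (by linarith), mk_update_pt i x (Susp.mk_eq_pt.2 (.inr (.inr rfl))), f.map_pt]
      rfl
  rw [e]
  conv => rhs; rw [← PMap.comp_reparam_id f i]
  exact PMap.comp_reparam_homotopic f i _ _ _ _ (Subtype.ext (by rw [coe_low]; simp))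
    (low_eq_one (by norm_num))

theorem PMap.neg_addAt [T1Space A] (i : Fin n) (f : PMap (Smash n (Susp A)) W) :
    (PMap.addAt i (PMap.negAt i f) f).Homotopic (PMap.const _ _) := by
  let V : I → I := fun t => ⟨|2 * (t : ℝ) - 1|, abs_nonneg _, by
    have := t.2.1; have := t.2.2; rw [abs_le]; constructor <;> linarith⟩
  have hV : Continuous V := by
    refine Continuous.subtype_mk ?_ _
    fun_prop
  have V0 : V 0 = 1 := Subtype.ext (by simp [V])
  have V1 : V 1 = 1 := Subtype.ext (by simp [V]; norm_num)
  have hE : EndPres V := ⟨.inr V0, .inr V1⟩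
  have e : PMap.addAt i (PMap.negAt i f) f = f.comp (PMap.reparam i V hE hV) := by
    refine PMap.ext_coord i fun x a t hx => ?_
    rw [PMap.addAt_mk i _ _ x a t hx, PMap.comp_reparam_mk f i _ _ x a t hx]
    split_ifs with h
    · rw [PMap.negAt, PMap.comp_reparam_mk f i _ _ _ a (low t) (by simp), Function.update_idem]
      congr 4
      refine Subtype.ext ?_
      simp only [unitInterval.coe_symm_eq, coe_low, V]
      rw [min_eq_right (by linarith), abs_of_nonpos (by linarith)]
      ring
    · congr 4
      refine Subtype.ext ?_
      simp only [coe_high, V]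
      rw [max_eq_right (by linarith), abs_of_nonneg (by linarith)]
  have hone : EndPres (fun _ => 1) := ⟨.inr rfl, .inr rfl⟩
  have e' : PMap.const _ _ = f.comp (PMap.reparam i (fun _ => 1) hone continuous_const) := by
    refine PMap.ext_coord i fun x a t hx => ?_
    rw [PMap.comp_reparam_mk f i hone continuous_const x a t hx,
      mk_update_pt i x (Susp.mk_eq_pt.2 (.inr (.inr rfl))), f.map_pt]
    rfl
  rw [e, e']
  exact PMap.comp_reparam_homotopic f i _ _ _ _ V0 V1

theorem PMap.addAt_assoc [T1Space A] (i : Fin n) (f g h : PMap (Smash n (Susp A)) W) :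
    (PMap.addAt i (PMap.addAt i f g) h).Homotopic (PMap.addAt i f (PMap.addAt i g h)) := by
  let θ : I → I := fun t => ⟨min (2 * (t : ℝ)) (min (t + 1 / 4) ((t + 1) / 2)), by
    have a := t.2.1
    have b := t.2.2
    refine ⟨le_min (by linarith) (le_min (by linarith) (by linarith)), ?_⟩
    exact (min_le_right _ _).trans ((min_le_right _ _).trans (by linarith))⟩
  have hc : Continuous θ := by
    refine Continuous.subtype_mk ?_ _
    fun_prop
  have θ0 : θ 0 = 0 := Subtype.ext (by simp [θ])
  have θ1 : θ 1 = 1 := Subtype.ext (by simp [θ])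
  have hE : EndPres θ := ⟨.inl θ0, .inr θ1⟩
  have e : PMap.addAt i (PMap.addAt i f g) h =
      (PMap.addAt i f (PMap.addAt i g h)).comp (PMap.reparam i θ hE hc) := by
    refine PMap.ext_coord i fun x a t hx => ?_
    rw [PMap.comp_reparam_mk _ i _ _ x a t hx, PMap.addAt_mk i _ _ x a t hx,
      PMap.addAt_mk i _ _ _ a (low t) (by simp), PMap.addAt_mk i _ _ _ a (θ t) (by simp),
      PMap.addAt_mk i _ _ _ a (high (θ t)) (by simp)]
    simp only [Function.update_idem]
    have l1 := coe_low t
    have l2 := coe_low (low t)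
    have l3 := coe_high (low t)
    have l4 := coe_high t
    have l5 := coe_low (θ t)
    have l6 := coe_high (θ t)
    have l7 := coe_low (high (θ t))
    have l8 := coe_high (high (θ t))
    have l0 : (θ t : ℝ) = min (2 * (t : ℝ)) (min (t + 1 / 4) ((t + 1) / 2)) := rfl
    have t0 := t.2.1
    have t1 := t.2.2
    rcases le_or_gt (t : ℝ) (1 / 4) with c1 | c1
    · have q0 : (θ t : ℝ) = 2 * t := by
        rw [l0, min_eq_left (le_min (by linarith) (by linarith))]
      have q1 : (low t : ℝ) = 2 * t := by rw [l1, min_eq_right (by linarith)]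
      rw [if_pos (by linarith), if_pos (by rw [q1]; linarith), if_pos (by rw [q0]; linarith)]
      have : low t = θ t := Subtype.ext (by rw [q0, q1])
      rw [this]
    · rcases le_or_gt (t : ℝ) (1 / 2) with c2 | c2
      · have q0 : (θ t : ℝ) = t + 1 / 4 := by
          rw [l0, min_eq_left (a := (t : ℝ) + 1 / 4) (by linarith), min_eq_right (by linarith)]
        have q1 : (low t : ℝ) = 2 * t := by rw [l1, min_eq_right (by linarith)]
        have q6 : (high (θ t) : ℝ) = 2 * (t + 1 / 4) - 1 := by
          rw [l6, q0, max_eq_right (by linarith)]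
        rw [if_pos c2, if_neg (by rw [q1]; linarith), if_neg (by rw [q0]; linarith),
          if_pos (by rw [q6]; linarith)]
        have : high (low t) = low (high (θ t)) := Subtype.ext (by
          rw [l3, l7, q1, q6, max_eq_right (by linarith), min_eq_right (by linarith)]
          ring)
        rw [this]
      · have q0 : (θ t : ℝ) = (t + 1) / 2 := by
          rw [l0, min_eq_right (a := (t : ℝ) + 1 / 4) (by linarith), min_eq_right (by linarith)]
        have q6 : (high (θ t) : ℝ) = t := by
          rw [l6, q0, max_eq_right (by linarith)]
          ring
        rw [if_neg (by linarith), if_neg (by rw [q0]; linarith), if_neg (by rw [q6]; linarith)]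
        have : high t = high (high (θ t)) := Subtype.ext (by rw [l4, l8, q6])
        rw [this]
  rw [e]
  conv => rhs; rw [← PMap.comp_reparam_id (PMap.addAt i f (PMap.addAt i g h)) i]
  exact PMap.comp_reparam_homotopic _ i _ _ _ _ θ0 θ1

/-- The interchange law for the sums formed with two different suspension coordinates. -/
theorem PMap.addAt_interchange [T1Space A] {i j : Fin n} (hij : i ≠ j)
    (f g h k : PMap (Smash n (Susp A)) W) :
    PMap.addAt i (PMap.addAt j f g) (PMap.addAt j h k) =
      PMap.addAt j (PMap.addAt i f h) (PMap.addAt i g k) := by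
  refine PMap.ext_coord i fun x a t hx => ?_
  obtain ⟨⟨b, s⟩, hy⟩ := Quotient.exists_rep (x j)
  have hy : x j = Susp.mk b s := hy.symm
  rw [PMap.addAt_mk i _ _ x a t hx, PMap.addAt_mk j _ _ x b s hy,
    PMap.addAt_mk j _ _ _ b s (by rw [Function.update_of_ne hij.symm, hy]),
    PMap.addAt_mk j _ _ _ b s (by rw [Function.update_of_ne hij.symm, hy]),
    PMap.addAt_mk i _ _ _ a t (by rw [Function.update_of_ne hij, hx]),
    PMap.addAt_mk i _ _ _ a t (by rw [Function.update_of_ne hij, hx])]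
  simp only [Function.update_comm hij]
  split_ifs <;> rfl

end Add

section Group

variable {n : ℕ} {A : Type u} [TopologicalSpace A] [Based A] [T1Space A] {W : Type v}
  [TopologicalSpace W] [Based W]

/-- The sum of homotopy classes formed with the `i`-th suspension coordinate. -/
def HClass.addAt (i : Fin n) : HClass (Smash n (Susp A)) W → HClass (Smash n (Susp A)) W →
    HClass (Smash n (Susp A)) W :=
  Quotient.map₂ (PMap.addAt i) fun _ _ h _ _ k => PMap.addAt_homotopic i h k

/-- The group structure on `[(ΣA)^{(n)}, W]`, `n ≥ 1`, given by the co-`H` structure of the first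
suspension coordinate. -/
instance HClass.addGroup [NeZero n] : AddGroup (HClass (Smash n (Susp A)) W) :=
  letI : Add (HClass (Smash n (Susp A)) W) := ⟨HClass.addAt 0⟩
  letI : Zero (HClass (Smash n (Susp A)) W) := ⟨PMap.cls (PMap.const _ _)⟩
  letI : Neg (HClass (Smash n (Susp A)) W) := ⟨Quotient.map (PMap.negAt 0)
    fun _ _ h => PMap.comp_homotopic h (.refl _)⟩
  AddGroup.ofLeftAxioms
    (fun a b c => Quotient.inductionOn₃ a b c fun f g h => Quotient.sound (PMap.addAt_assoc 0 f g h))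
    (fun a => Quotient.inductionOn a fun f => Quotient.sound (PMap.zero_addAt 0 f))
    (fun a => Quotient.inductionOn a fun f => Quotient.sound (PMap.neg_addAt 0 f))

theorem HClass.cls_add [NeZero n] (f g : PMap (Smash n (Susp A)) W) :
    f.cls + g.cls = (PMap.addAt 0 f g).cls := rfl

/-- For `n ≥ 2` the group `[(ΣA)^{(n)}, W]` is abelian. -/
theorem HClass.add_comm_of_two_le [NeZero n] (hn : 2 ≤ n)
    (a b : HClass (Smash n (Susp A)) W) : a + b = b + a := by
  have hu : ∀ i : Fin n, EckmannHilton.IsUnital (HClass.addAt (A := A) (W := W) i)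
      (PMap.cls (PMap.const _ _)) := fun i =>
    { left_id := fun a => Quotient.inductionOn a fun f => Quotient.sound (PMap.zero_addAt i f)
      right_id := fun a => Quotient.inductionOn a fun f => Quotient.sound (PMap.addAt_zero i f) }
  have hij : (0 : Fin n) ≠ ⟨1, hn⟩ := by
    intro h
    have := congrArg Fin.val h
    simp at this
  have hd : ∀ a b c d : HClass (Smash n (Susp A)) W,
      HClass.addAt ⟨1, hn⟩ (HClass.addAt 0 a b) (HClass.addAt 0 c d) =
        HClass.addAt 0 (HClass.addAt ⟨1, hn⟩ a c) (HClass.addAt ⟨1, hn⟩ b d) := by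
    intro a b c d
    refine Quotient.inductionOn₂ a b (fun f g => Quotient.inductionOn₂ c d (fun h k => ?_))
    exact congrArg PMap.cls (PMap.addAt_interchange hij.symm f g h k)
  exact (EckmannHilton.mul_comm (hu ⟨1, hn⟩) (hu 0) hd).comm a b

end Group

/-! ### Permutations and the action of the group ring -/

section Perm

variable {n : ℕ} {X : Type u} [TopologicalSpace X] [Based X]

/-- The action of a permutation on `X^{(n)}` by permuting positions: the `i`-th factor is moved to
position `τ i`. -/
def permMap (τ : Equiv.Perm (Fin n)) : PMap (Smash n X) (Smash n X) where
  toMap := ⟨Smash.lift (fun x => Smash.mk fun i => x (τ.symm i)) Based.pt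
      (fun x ⟨i, hi⟩ => Smash.mk_eq_pt (i := τ i) (by simpa using hi)), by
    rw [Smash.continuous_iff]
    intro K f
    exact Smash.continuous_mk_comp ⟨fun k i => f k (τ.symm i), by fun_prop⟩⟩
  map_pt := rfl

/-- The sum `∑_τ c τ` over all permutations, in an additive group. (All sums below take place in
`[(ΣA)^{(n)}, (ΣA)^{(n)}]`, where the order of the summands is immaterial: for `n = 1` there is
one summand, and for `n ≥ 2` the group is abelian.) -/
def permSum {G : Type v} [AddGroup G] (c : Equiv.Perm (Fin n) → G) : G :=
  ((Finset.univ : Finset (Equiv.Perm (Fin n))).toList.map c).sum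

/-- The trace map `φ_n = ∑_τ τ`, as an element of the group `[X^{(n)}, X^{(n)}]` for `X = ΣA`. -/
def traceClass (n : ℕ) [NeZero n] (A : Type u) [TopologicalSpace A] [Based A] [T1Space A] :
    HClass (Smash n (Susp A)) (Smash n (Susp A)) :=
  permSum fun τ : Equiv.Perm (Fin n) => (permMap τ).cls

end Perm

instance primeIdeal (p : ℕ) [Fact p.Prime] : (Ideal.span {(p : ℤ)}).IsPrime :=
  (Ideal.span_singleton_prime (by exact_mod_cast (Fact.out : p.Prime).ne_zero)).2
    (Nat.prime_iff_prime_int.1 Fact.out)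

/-- The ring `ℤ_(p)` of integers localized at the prime `p`. -/
abbrev ZLoc (p : ℕ) [Fact p.Prime] : Type := Localization.AtPrime (Ideal.span {(p : ℤ)})

/-- The class `c` in `[X^{(n)}, X^{(n)}]`, `X = ΣA`, is `∑_τ k_τ τ` where `∑_τ k_τ τ = e` is a
given element of the group ring `ℤ_(p)(Σ_n)`: for some common denominator `N` of the coefficients,
`N c = ∑_τ (N k_τ) τ`. -/
def Represents (p : ℕ) [Fact p.Prime] {n : ℕ} [NeZero n] {A : Type u} [TopologicalSpace A]
    [Based A] [T1Space A] (e : MonoidAlgebra (ZLoc p) (Equiv.Perm (Fin n)))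
    (c : HClass (Smash n (Susp A)) (Smash n (Susp A))) : Prop :=
  ∃ (N : ℕ) (k : Equiv.Perm (Fin n) → ℤ), ¬ p ∣ N ∧
    (∀ τ, (N : ZLoc p) * e.coeff τ = (k τ : ZLoc p)) ∧
    N • c = permSum fun τ : Equiv.Perm (Fin n) => k τ • (permMap τ).cls

/-- A simply connected space is `p`-local if all its homotopy groups are `ℤ_(p)`-modules, that is,
uniquely divisible by all primes different from `p`. -/
def IsPLocal (p : ℕ) (X : Type u) [TopologicalSpace X] [Based X] : Prop :=
  SimplyConnectedSpace X ∧ ∀ (m q : ℕ), q.Prime → q ≠ p →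
    Function.Bijective fun g : HomotopyGroup (Fin (m + 1)) X Based.pt => g ^ q

/-! ### Functorial retracts of the tensor power functor -/

/-- A functorial retract of the functor `V ↦ V^{⊗n}` on `R`-modules, given by a natural idempotent
(the retract being its image). -/
structure FunctorialRetract (R : Type u) [CommRing R] (n : ℕ) where
  proj : ∀ (V : Type u) [AddCommGroup V] [Module R V],
    (⨂[R] _ : Fin n, V) →ₗ[R] (⨂[R] _ : Fin n, V)
  natural : ∀ (V V' : Type u) [AddCommGroup V] [Module R V] [AddCommGroup V'] [Module R V']
    (f : V →ₗ[R] V'), (PiTensorProduct.map fun _ : Fin n => f) ∘ₗ proj V =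
      proj V' ∘ₗ (PiTensorProduct.map fun _ : Fin n => f)
  idem : ∀ (V : Type u) [AddCommGroup V] [Module R V], proj V ∘ₗ proj V = proj V

namespace FunctorialRetract

variable {R : Type u} [CommRing R] {n : ℕ}

/-- The retract contains the bottom cell: it contains all the elements `v ⊗ ⋯ ⊗ v`. -/
def ContainsBottomCell (M : FunctorialRetract R n) : Prop :=
  ∀ (V : Type u) [AddCommGroup V] [Module R V] (v : V),
    M.proj V (PiTensorProduct.tprod R fun _ : Fin n => v) =
      PiTensorProduct.tprod R fun _ : Fin n => v

/-- `M` is a functorial retract of `M'`, compatibly with the projections from `V^{⊗n}`. -/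
def IsRetractOf (M M' : FunctorialRetract R n) : Prop :=
  ∀ (V : Type u) [AddCommGroup V] [Module R V],
    M.proj V ∘ₗ M'.proj V = M.proj V ∧ M'.proj V ∘ₗ M.proj V = M.proj V

/-- `M` is a smallest functorial retract that contains the bottom cell: it contains the bottom
cell, and no proper functorial retract of it does. -/
def IsSmallest (M : FunctorialRetract R n) : Prop :=
  M.ContainsBottomCell ∧ ∀ M' : FunctorialRetract R n,
    M'.ContainsBottomCell → M'.IsRetractOf M → M.IsRetractOf M'

/-- The natural idempotent of `M` is given by the element `e` of the group ring, which acts on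
`V^{⊗n}` by permuting positions. -/
def IsInducedBy (M : FunctorialRetract R n) (e : MonoidAlgebra R (Equiv.Perm (Fin n))) : Prop :=
  ∀ (V : Type u) [AddCommGroup V] [Module R V],
    M.proj V = ∑ τ : Equiv.Perm (Fin n),
      e.coeff τ • (PiTensorProduct.reindex R (fun _ : Fin n => V) τ).toLinearMap

end FunctorialRetract

/-! ### Homotopy colimits -/

section Telescope

variable {Y : Type u} [TopologicalSpace Y] [Based Y]

/-- The identifications of the reduced mapping telescope. -/
inductive TelescopeRel (f : PMap Y Y) : ℕ × I × Y → ℕ × I × Y → Prop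
  | glue (k : ℕ) (y : Y) : TelescopeRel f (k, 1, y) (k + 1, 0, f.toMap y)
  | base (k : ℕ) (t : I) : TelescopeRel f (k, t, Based.pt) (0, 0, Based.pt)

/-- The homotopy colimit `hocolim_f Y` of the sequence `Y → Y → Y → ⋯` all of whose maps are `f`:
the reduced mapping telescope. -/
def Hocolim (f : PMap Y Y) : Type u := Quot (TelescopeRel f)

instance (f : PMap Y Y) : TopologicalSpace (Hocolim f) :=
  inferInstanceAs (TopologicalSpace (Quot (TelescopeRel f)))

instance (f : PMap Y Y) : Based (Hocolim f) := ⟨Quot.mk _ (0, 0, Based.pt)⟩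

/-- The canonical map from the first term of the sequence to the homotopy colimit. -/
def Hocolim.incl (f : PMap Y Y) : PMap Y (Hocolim f) where
  toMap := ⟨fun y => Quot.mk (TelescopeRel f) (0, 0, y),
    continuous_quot_mk.comp (by fun_prop : Continuous fun y : Y => ((0 : ℕ), (0 : I), y))⟩
  map_pt := rfl

end Telescope

end LabelTrace

end

noncomputable section

open scoped unitInterval TensorProduct

namespace LabelTrace

universe u v w

/-! ### Wrapping the unit interval around itself -/

/-- The `k`-fold wrapping `I/∂I → I/∂I`, in the parametrization used for iterated sums. -/
def wrap : ℕ → I → I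
  | 0, _ => 0
  | k + 1, t => if (t : ℝ) ≤ 1 / 2 then low t else wrap k (high t)

theorem low_zero : low 0 = 0 := Subtype.ext (by rw [coe_low]; simp)

theorem high_one : high 1 = 1 := Subtype.ext (by rw [coe_high]; norm_num)

theorem wrap_zero (k : ℕ) : wrap k 0 = 0 := by
  cases k with
  | zero => rfl
  | succ k => rw [wrap, if_pos (by norm_num), low_zero]

theorem wrap_one (k : ℕ) : wrap k 1 = 0 := by
  induction k with
  | zero => rfl
  | succ k ih => rw [wrap, if_neg (by norm_num), high_one, ih]

theorem continuous_comp_wrap {T : Type u} {Y : Type v} [TopologicalSpace T] [TopologicalSpace Y]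
    {F : T × I → Y} (hF : Continuous F) (h : ∀ x, F (x, 0) = F (x, 1)) (k : ℕ) :
    Continuous fun q : T × I => F (q.1, wrap k q.2) := by
  induction k with
  | zero => exact hF.comp (by fun_prop : Continuous fun q : T × I => (q.1, (0 : I)))
  | succ k ih =>
    have e : (fun q : T × I => F (q.1, wrap (k + 1) q.2)) = fun q =>
        if (q.2 : ℝ) ≤ 1 / 2 then F (q.1, low q.2) else F (q.1, wrap k (high q.2)) := by
      funext q
      rw [wrap]
      split_ifs <;> rfl
    rw [e]
    have cl := continuous_low
    have ch := continuous_high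
    refine Continuous.if_le (hF.comp (by fun_prop))
      (ih.comp (by fun_prop : Continuous fun q : T × I => (q.1, high q.2)))
      (by fun_prop) (by fun_prop) fun q hq => ?_
    rw [low_eq_one hq.ge, high_eq_zero hq.le, wrap_zero, h]

/-! ### Maps out of a suspension -/

section SuspMaps

variable {A : Type u} [TopologicalSpace A] [Based A] {Y : Type v} [TopologicalSpace Y] [Based Y]

/-- A map out of the suspension from a map on `A × [0,1]`. -/
def PMap.ofSusp (F : A → I → Y) (hc : Continuous fun q : A × I => F q.1 q.2)
    (h : ∀ a t, (a = Based.pt ∨ t = 0 ∨ t = 1) → F a t = Based.pt) : PMap (Susp A) Y where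
  toMap := ⟨Quotient.lift (fun q : A × I => F q.1 q.2) (by
      rintro x y (rfl | ⟨hx, hy⟩)
      · rfl
      · rw [h _ _ hx, h _ _ hy]), hc.quotient_lift _⟩
  map_pt := h _ _ (.inl rfl)

theorem PMap.ext_susp {f g : PMap (Susp A) Y}
    (h : ∀ a t, f.toMap (Susp.mk a t) = g.toMap (Susp.mk a t)) : f = g :=
  PMap.ext_apply (Susp.ind h)

theorem PMap.map_susp_pt (f : PMap (Susp A) Y) {a : A} {t : I}
    (h : a = Based.pt ∨ t = 0 ∨ t = 1) : f.toMap (Susp.mk a t) = Based.pt := by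
  rw [Susp.mk_eq_pt.2 h, f.map_pt]

/-- The self map of degree `k` of a suspension. -/
def suspWrap (A : Type u) [TopologicalSpace A] [Based A] (k : ℕ) : PMap (Susp A) (Susp A) :=
  PMap.ofSusp (fun a t => Susp.mk a (wrap k t))
    (continuous_comp_wrap (F := fun q : A × I => Susp.mk q.1 q.2) Susp.continuous_mk
      (fun _ => Susp.mk_eq_iff.2 (.inr ⟨.inr (.inl rfl), .inr (.inr rfl)⟩)) k)
    (by
      rintro a t (h | rfl | rfl)
      · exact Susp.mk_eq_pt.2 (.inl h)
      · exact Susp.mk_eq_pt.2 (.inr (.inl (wrap_zero k)))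
      · exact Susp.mk_eq_pt.2 (.inr (.inl (wrap_one k))))

@[simp] theorem suspWrap_mk (k : ℕ) (a : A) (t : I) :
    (suspWrap A k).toMap (Susp.mk a t) = Susp.mk a (wrap k t) := rfl

end SuspMaps

section OnCoord

variable {n : ℕ} {X : Type u} [TopologicalSpace X] [Based X]

/-- Apply a pointed map in the `i`-th smash factor. -/
def PMap.onCoord (i : Fin n) (g : PMap X X) : PMap (Smash n X) (Smash n X) where
  toMap := ⟨Smash.onCoord i g.toMap g.map_pt,
    (Smash.continuous_onCoord (P := Unit) i (fun _ => g.toMap) (fun _ => g.map_pt)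
      (by fun_prop)).comp (by fun_prop : Continuous fun z : Smash n X => ((), z))⟩
  map_pt := Smash.onCoord_pt i g.toMap g.map_pt

theorem PMap.onCoord_mk (i : Fin n) (g : PMap X X) (x : Fin n → X) :
    (PMap.onCoord i g).toMap (Smash.mk x) = Smash.mk (Function.update x i (g.toMap (x i))) := rfl

theorem PMap.onCoord_id (i : Fin n) : PMap.onCoord i (PMap.id X) = PMap.id (Smash n X) :=
  PMap.ext_apply (Smash.ind fun x => by
    rw [PMap.onCoord_mk]
    exact congrArg Smash.mk (Function.update_eq_self i x))

theorem PMap.onCoord_comp (i : Fin n) (g h : PMap X X) :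
    PMap.onCoord i (g.comp h) = (PMap.onCoord i g).comp (PMap.onCoord i h) :=
  PMap.ext_apply (Smash.ind fun x => by
    change _ = (PMap.onCoord i g).toMap ((PMap.onCoord i h).toMap (Smash.mk x))
    rw [PMap.onCoord_mk, PMap.onCoord_mk, PMap.onCoord_mk, Function.update_idem,
      Function.update_self]
    rfl)

theorem PMap.onCoord_homotopic (i : Fin n) {g h : PMap X X} (e : g.Homotopic h) :
    (PMap.onCoord i g).Homotopic (PMap.onCoord i h) := by
  obtain ⟨F, cF, F0, F1, Fp⟩ := e.family
  refine PMap.homotopic_of_family _ _ (fun s => Smash.onCoord i (F s) (Fp s))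
    (Smash.continuous_onCoord i F Fp cF) ?_ ?_ fun s => Smash.onCoord_pt i _ _
  all_goals refine Smash.ind fun x => ?_
  · rw [Smash.onCoord_mk, F0, PMap.onCoord_mk]
  · rw [Smash.onCoord_mk, F1, PMap.onCoord_mk]

end OnCoord

section Multiples

variable {n : ℕ} {A : Type u} [TopologicalSpace A] [Based A] [T1Space A] {W : Type v}
  [TopologicalSpace W] [Based W]

/-- Multiples of a homotopy class are formed by precomposition with maps of a given degree. -/
theorem HClass.nsmul_cls [NeZero n] (f : PMap (Smash n (Susp A)) W) (k : ℕ) :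
    k • f.cls = (f.comp (PMap.onCoord 0 (suspWrap A k))).cls := by
  induction k with
  | zero =>
    rw [zero_nsmul]
    change PMap.cls _ = _
    congr 1
    refine PMap.ext_coord 0 fun x a t hx => ?_
    change _ = f.toMap ((PMap.onCoord 0 (suspWrap A 0)).toMap (Smash.mk x))
    rw [PMap.onCoord_mk, hx, suspWrap_mk, wrap, mk_update_pt 0 x
      (Susp.mk_eq_pt.2 (.inr (.inl rfl))), f.map_pt]
    rfl
  | succ k ih =>
    rw [succ_nsmul', ih, HClass.cls_add]
    congr 1
    refine PMap.ext_coord 0 fun x a t hx => ?_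
    change _ = f.toMap ((PMap.onCoord 0 (suspWrap A (k + 1))).toMap (Smash.mk x))
    rw [PMap.addAt_mk 0 _ _ x a t hx, PMap.onCoord_mk, hx, suspWrap_mk, wrap]
    split_ifs
    · rfl
    · change f.toMap ((PMap.onCoord 0 (suspWrap A k)).toMap _) = _
      rw [PMap.onCoord_mk, Function.update_self, suspWrap_mk, Function.update_idem]

/-- If the self map of degree `N` of `ΣA` is a homotopy equivalence, then `[(ΣA)^{(n)}, W]` is
uniquely `N`-divisible. -/
theorem HClass.nsmul_bijective [NeZero n] {N : ℕ} (g : PMap (Susp A) (Susp A))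
    (hl : (g.comp (suspWrap A N)).Homotopic (PMap.id _))
    (hr : ((suspWrap A N).comp g).Homotopic (PMap.id _)) :
    Function.Bijective fun c : HClass (Smash n (Susp A)) W => N • c := by
  have key : ∀ g h : PMap (Susp A) (Susp A), (g.comp h).Homotopic (PMap.id _) →
      ∀ f : PMap (Smash n (Susp A)) W,
        ((f.comp (PMap.onCoord 0 g)).comp (PMap.onCoord 0 h)).Homotopic f := by
    intro g h e f
    have := PMap.onCoord_homotopic (n := n) 0 e
    rw [PMap.onCoord_comp, PMap.onCoord_id] at this
    exact PMap.comp_homotopic (.refl f.toMap) this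
  constructor
  · intro c c'
    refine Quotient.inductionOn₂ c c' fun f f' h => Quotient.sound ?_
    change N • f.cls = N • f'.cls at h
    rw [HClass.nsmul_cls, HClass.nsmul_cls] at h
    have h' : PMap.Homotopic _ _ := Quotient.exact h
    have h2 := PMap.comp_homotopic h' (f := PMap.onCoord 0 g) (.refl _)
    exact ((key _ _ hr f).symm.trans h2).trans (key _ _ hr f')
  · intro c
    refine Quotient.inductionOn c fun f => ⟨(f.comp (PMap.onCoord 0 g)).cls, ?_⟩
    change N • PMap.cls _ = _
    rw [HClass.nsmul_cls]
    exact Quotient.sound (key _ _ hl f)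

end Multiples

/-! ### Composition and sums of homotopy classes -/

section SumComp

variable {n : ℕ} {A : Type u} [TopologicalSpace A] [Based A] [T1Space A] {W : Type v}
  [TopologicalSpace W] [Based W] {W' : Type w} [TopologicalSpace W'] [Based W']

/-- Composition with a fixed map on the left is additive. -/
def HClass.postcomp [NeZero n] (f : PMap W W') :
    HClass (Smash n (Susp A)) W →+ HClass (Smash n (Susp A)) W' :=
  AddMonoidHom.mk' (Quotient.map f.comp fun _ _ h => PMap.comp_homotopic (.refl f.toMap) h) (by
    intro a b
    refine Quotient.inductionOn₂ a b fun g h => ?_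
    refine congrArg PMap.cls (PMap.ext_coord 0 fun x a t hx => ?_)
    change f.toMap ((PMap.addAt 0 g h).toMap (Smash.mk x)) = _
    rw [PMap.addAt_mk 0 _ _ x a t hx, PMap.addAt_mk 0 _ _ x a t hx]
    split_ifs <;> rfl)

theorem HClass.postcomp_cls [NeZero n] (f : PMap W W') (g : PMap (Smash n (Susp A)) W) :
    HClass.postcomp f g.cls = (f.comp g).cls := rfl

theorem HClass.addAt_eq_add [NeZero n] (i : Fin n) (a b : HClass (Smash n (Susp A)) W) :
    HClass.addAt i a b = a + b := by
  by_cases hi : i = 0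
  · subst hi; rfl
  have hu : ∀ i : Fin n, EckmannHilton.IsUnital (HClass.addAt (A := A) (W := W) i)
      (PMap.cls (PMap.const _ _)) := fun i =>
    { left_id := fun a => Quotient.inductionOn a fun f => Quotient.sound (PMap.zero_addAt i f)
      right_id := fun a => Quotient.inductionOn a fun f => Quotient.sound (PMap.addAt_zero i f) }
  have hd : ∀ a b c d : HClass (Smash n (Susp A)) W,
      HClass.addAt i (HClass.addAt 0 a b) (HClass.addAt 0 c d) =
        HClass.addAt 0 (HClass.addAt i a c) (HClass.addAt i b d) := by
    intro a b c d
    refine Quotient.inductionOn₂ a b (fun f g => Quotient.inductionOn₂ c d (fun h k => ?_))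
    exact congrArg PMap.cls (PMap.addAt_interchange hi f g h k)
  exact congrFun (congrFun (EckmannHilton.mul (hu i) (hu 0) hd) a) b

theorem permMap_mk {X : Type u} [TopologicalSpace X] [Based X] (τ : Equiv.Perm (Fin n))
    (x : Fin n → X) : (permMap τ).toMap (Smash.mk x) = Smash.mk fun i => x (τ.symm i) := rfl

theorem permMap_comp {X : Type u} [TopologicalSpace X] [Based X] (ρ τ : Equiv.Perm (Fin n)) :
    (permMap ρ).comp (permMap τ) = (permMap (ρ * τ) : PMap (Smash n X) (Smash n X)) :=
  PMap.ext_apply (Smash.ind fun _ => rfl)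

theorem PMap.addAt_comp_permMap (τ : Equiv.Perm (Fin n)) (i : Fin n)
    (f g : PMap (Smash n (Susp A)) W) : (PMap.addAt i f g).comp (permMap τ) =
      PMap.addAt (τ.symm i) (f.comp (permMap τ)) (g.comp (permMap τ)) := by
  refine PMap.ext_coord (τ.symm i) fun x a t hx => ?_
  have hup : ∀ z, (fun j => Function.update x (τ.symm i) z (τ.symm j)) =
      Function.update (fun j => x (τ.symm j)) i z := fun z => by
    funext j
    by_cases h : j = i
    · subst h; simp
    · rw [Function.update_of_ne h, Function.update_of_ne (fun h' => h (τ.symm.injective h'))]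
  change (PMap.addAt i f g).toMap ((permMap τ).toMap (Smash.mk x)) = _
  rw [permMap_mk, PMap.addAt_mk i _ _ _ a t hx, PMap.addAt_mk (τ.symm i) _ _ x a t hx]
  change _ = if _ then f.toMap ((permMap τ).toMap _) else g.toMap ((permMap τ).toMap _)
  rw [permMap_mk, permMap_mk, hup, hup]

/-- Composition with a permutation on the right is additive. -/
def HClass.precompPerm [NeZero n] (τ : Equiv.Perm (Fin n)) :
    HClass (Smash n (Susp A)) W →+ HClass (Smash n (Susp A)) W :=
  AddMonoidHom.mk' (Quotient.map (fun f => f.comp (permMap τ)) fun _ _ h =>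
      PMap.comp_homotopic h (.refl (permMap τ).toMap)) (by
    intro a b
    refine Eq.trans ?_ (HClass.addAt_eq_add (τ.symm 0) _ _)
    refine Quotient.inductionOn₂ a b fun g h => ?_
    exact congrArg PMap.cls (PMap.addAt_comp_permMap τ 0 g h))

theorem HClass.precompPerm_cls [NeZero n] (τ : Equiv.Perm (Fin n))
    (f : PMap (Smash n (Susp A)) W) :
    HClass.precompPerm τ f.cls = (f.comp (permMap τ)).cls := rfl

theorem HClass.comm_or [NeZero n] :
    n = 1 ∨ ∀ a b : HClass (Smash n (Susp A)) W, a + b = b + a := by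
  have := NeZero.ne n
  rcases Nat.lt_or_ge n 2 with h | h
  · left; omega
  · exact .inr (HClass.add_comm_of_two_le h)

end SumComp

section PermSum

variable {n : ℕ} {G : Type v} [AddGroup G] {H : Type w} [AddGroup H]

theorem map_permSum (f : G →+ H) (c : Equiv.Perm (Fin n) → G) :
    f (permSum c) = permSum fun τ => f (c τ) := by
  rw [permSum, permSum, map_list_sum, List.map_map]
  rfl

theorem permSum_eq_sum {G : Type v} [AddCommGroup G] (c : Equiv.Perm (Fin n) → G) :
    permSum c = ∑ τ, c τ := Finset.sum_map_toList _ _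

theorem permSum_zsmul_const (k : Equiv.Perm (Fin n) → ℤ) (g : G) :
    (permSum fun τ => k τ • g) = (∑ τ, k τ) • g := by
  rw [← permSum_eq_sum]
  exact (map_permSum (zmultiplesHom G g) k).symm

theorem permSum_of_eq_one (h : n = 1) (c : Equiv.Perm (Fin n) → G) : permSum c = c 1 := by
  subst h
  simp [permSum]

theorem permSum_mul_right (hG : n = 1 ∨ ∀ a b : G, a + b = b + a) (c : Equiv.Perm (Fin n) → G)
    (ρ : Equiv.Perm (Fin n)) : (permSum fun τ => c (τ * ρ)) = permSum c := by
  rcases hG with h | h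
  · rw [permSum_of_eq_one h, permSum_of_eq_one h]
    subst h
    exact congrArg c (Subsingleton.elim _ _)
  · let _ : AddCommGroup G := { (inferInstance : AddGroup G) with add_comm := h }
    refine (permSum_eq_sum _).trans (Eq.trans ?_ (permSum_eq_sum c).symm)
    exact Equiv.sum_comp (Equiv.mulRight ρ) c

theorem nsmul_permSum (hG : n = 1 ∨ ∀ a b : G, a + b = b + a) (c : Equiv.Perm (Fin n) → G)
    (N : ℕ) : N • permSum c = permSum fun τ => N • c τ := by
  rcases hG with h | h
  · rw [permSum_of_eq_one h, permSum_of_eq_one h]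
  · let _ : AddCommGroup G := { (inferInstance : AddGroup G) with add_comm := h }
    refine (congrArg (N • ·) (permSum_eq_sum c)).trans (Eq.trans ?_ (permSum_eq_sum _).symm)
    exact Finset.smul_sum

end PermSum

/-! ### Coefficients in `ℤ_(p)` -/

section Coefficients

variable {p : ℕ} [Fact p.Prime]

theorem ZLoc.intCast_injective : Function.Injective (Int.cast : ℤ → ZLoc p) := by
  have := IsLocalization.injective (ZLoc p)
    (Ideal.primeCompl_le_nonZeroDivisors (Ideal.span {(p : ℤ)}))
  intro a b h
  exact this (by simpa using h)

theorem ZLoc.exists_common_denominator {ι : Type*} [Fintype ι] (e : ι → ZLoc p) :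
    ∃ (N : ℕ) (k : ι → ℤ), ¬ p ∣ N ∧ ∀ i, (N : ZLoc p) * e i = (k i : ZLoc p) := by
  obtain ⟨b, hb⟩ := IsLocalization.exist_integer_multiples_of_finite
    (Ideal.span {(p : ℤ)}).primeCompl e
  choose k hk using hb
  have hb' : ¬ (p : ℤ) ∣ (b : ℤ) := by
    have := b.2
    rwa [Ideal.mem_primeCompl_iff, Ideal.mem_span_singleton] at this
  refine ⟨(b : ℤ).natAbs, fun i => (b : ℤ).sign * k i, fun h => hb' ?_, fun i => ?_⟩
  · exact Int.natCast_dvd.2 h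
  · have h1 := hk i
    rw [eq_intCast, Algebra.smul_def, eq_intCast] at h1
    have h2 : (((b : ℤ).natAbs : ℤ) : ZLoc p) = ((b : ℤ).sign * b : ℤ) := by
      rw [Int.sign_mul_self_eq_natAbs]
    rw [Int.cast_natCast] at h2
    rw [h2, Int.cast_mul, Int.cast_mul, h1, mul_assoc]

end Coefficients

section Classes

variable {p : ℕ} [Fact p.Prime] {n : ℕ} [NeZero n] {A : Type u} [TopologicalSpace A] [Based A]
  [T1Space A]

/-- Every element of `ℤ_(p)(Σ_n)` represents a unique homotopy class, if division by integers prime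
to `p` is unique. -/
theorem existsUnique_represents
    (hdiv : ∀ N : ℕ, ¬ p ∣ N → Function.Bijective
      fun c : HClass (Smash n (Susp A)) (Smash n (Susp A)) => N • c)
    (e : MonoidAlgebra (ZLoc p) (Equiv.Perm (Fin n))) :
    ∃! c : HClass (Smash n (Susp A)) (Smash n (Susp A)), Represents p e c := by
  obtain ⟨N, k, hN, hk⟩ := ZLoc.exists_common_denominator fun τ => e.coeff τ
  obtain ⟨c, hc⟩ := (hdiv N hN).2 (permSum fun τ => k τ • (permMap τ).cls)
  refine ⟨c, ⟨N, k, hN, hk, hc⟩, ?_⟩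
  rintro c' ⟨N', k', hN', hk', hc'⟩
  have hc : N • c = permSum fun τ => k τ • (permMap τ).cls := hc
  have hp : p.Prime := Fact.out
  refine (hdiv (N' * N) ?_).1 ?_
  · rw [hp.dvd_mul]; tauto
  · change (N' * N) • c' = (N' * N) • c
    have hkk : ∀ τ, (N : ℤ) * k' τ = N' * k τ := fun τ => by
      refine ZLoc.intCast_injective (p := p) ?_
      push_cast
      rw [← hk, ← hk']
      ring
    rw [mul_nsmul, hc', mul_nsmul', hc, nsmul_permSum HClass.comm_or,
      nsmul_permSum HClass.comm_or]
    congr 1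
    funext τ
    rw [← natCast_zsmul, ← mul_zsmul, ← natCast_zsmul, ← mul_zsmul, hkk]

/-- The trace map absorbs every element of augmentation one. -/
theorem trace_comp_eq
    (hdiv : ∀ N : ℕ, ¬ p ∣ N → Function.Bijective
      fun c : HClass (Smash n (Susp A)) (Smash n (Susp A)) => N • c)
    {e : MonoidAlgebra (ZLoc p) (Equiv.Perm (Fin n))} (he : ∑ τ, e.coeff τ = 1)
    {a φ : PMap (Smash n (Susp A)) (Smash n (Susp A))} (ha : Represents p e a.cls)
    (hφ : φ.cls = traceClass n A) : (φ.comp a).cls = φ.cls := by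
  obtain ⟨N, k, hN, hk, hc⟩ := ha
  have hsum : ∑ τ, k τ = N := by
    refine ZLoc.intCast_injective (p := p) ?_
    push_cast
    rw [← Finset.sum_congr rfl fun τ _ => hk τ, ← Finset.mul_sum, he, mul_one]
  have hτ : ∀ τ : Equiv.Perm (Fin n), (φ.comp (permMap τ)).cls = φ.cls := fun τ => by
    rw [← HClass.precompPerm_cls, hφ, traceClass, map_permSum]
    conv_rhs => rw [← permSum_mul_right HClass.comm_or _ τ]
    congr 1
    funext ρ
    rw [HClass.precompPerm_cls, permMap_comp]
  refine (hdiv N hN).1 ?_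
  change N • (φ.comp a).cls = N • φ.cls
  rw [← HClass.postcomp_cls, ← map_nsmul, hc, map_permSum]
  simp only [map_zsmul, HClass.postcomp_cls, hτ]
  rw [permSum_zsmul_const, hsum, natCast_zsmul]

/-- A map that absorbs `a` factors up to homotopy through the telescope of `a`. -/
theorem exists_factor_hocolim {Y : Type u} [TopologicalSpace Y] [Based Y] {Z : Type v}
    [TopologicalSpace Z] [Based Z] (a : PMap Y Y) (φ : PMap Y Z)
    (h : φ.Homotopic (φ.comp a)) : ∃ b : PMap (Hocolim a) Z, b.comp (Hocolim.incl a) = φ := by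
  obtain ⟨H, cH, H0, H1, Hp⟩ := h.family
  refine ⟨⟨⟨Quot.lift (fun q : ℕ × I × Y => H q.2.1 q.2.2) ?_, continuous_quot_lift _
    (cH.comp (by fun_prop : Continuous fun q : ℕ × I × Y => (q.2.1, q.2.2)))⟩, Hp 0⟩,
    PMap.ext_apply H0⟩
  rintro _ _ (⟨k, y⟩ | ⟨k, t⟩)
  · exact (H1 y).trans (H0 _).symm
  · exact (Hp t).trans (Hp 0).symm

end Classes

/-! ### Natural endomorphisms of the tensor power functor -/

section Natural

variable {R : Type u} [CommRing R] {n : ℕ}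

/-- The coordinate of a tensor in `(Rⁿ)^{⊗n}` that belongs to a word in the standard basis. -/
def wordCoord (R : Type u) [CommRing R] {n : ℕ} (w : Fin n → Fin n) :
    (⨂[R] _ : Fin n, (Fin n → R)) →ₗ[R] R :=
  PiTensorProduct.lift ((MultilinearMap.mkPiAlgebra R (Fin n) R).compLinearMap
    fun i => LinearMap.proj (w i))

theorem wordCoord_tprod (w : Fin n → Fin n) (v : Fin n → Fin n → R) :
    wordCoord R w (PiTensorProduct.tprod R v) = ∏ i, v i (w i) := by
  rw [wordCoord, PiTensorProduct.lift.tprod]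
  simp

theorem sum_wordCoord (t : ⨂[R] _ : Fin n, (Fin n → R)) :
    t = ∑ w : Fin n → Fin n, wordCoord R w t •
      PiTensorProduct.tprod R fun i => (Pi.single (w i) (1 : R) : Fin n → R) := by
  induction t using PiTensorProduct.induction_on with
  | smul_tprod r v =>
    have hv : v = fun i => ∑ j, v i j • (Pi.single j (1 : R) : Fin n → R) := by
      funext i
      exact pi_eq_sum_univ' (v i)
    have key : PiTensorProduct.tprod R v = ∑ w : Fin n → Fin n, (∏ i, v i (w i)) •
        PiTensorProduct.tprod R fun i => (Pi.single (w i) (1 : R) : Fin n → R) := by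
      conv_lhs => rw [hv]
      rw [MultilinearMap.map_sum]
      exact Finset.sum_congr rfl fun w _ => MultilinearMap.map_smul_univ _ _ _
    simp only [map_smul, wordCoord_tprod, smul_eq_mul, mul_smul]
    rw [← Finset.smul_sum, ← key]
  | add x y hx hy =>
    simp only [map_add, add_smul, Finset.sum_add_distrib]
    rw [← hx, ← hy]

/-- The endomorphism of `Rⁿ` that kills the `j`-th basis vector. -/
def killCoord (R : Type u) [CommRing R] {n : ℕ} (j : Fin n) : (Fin n → R) →ₗ[R] (Fin n → R) :=
  LinearMap.pi fun i => if i = j then 0 else LinearMap.proj i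

theorem wordCoord_map_killCoord (j : Fin n) {w : Fin n → Fin n} (hw : ∀ i, w i ≠ j)
    (t : ⨂[R] _ : Fin n, (Fin n → R)) :
    wordCoord R w (PiTensorProduct.map (fun _ => killCoord R j) t) = wordCoord R w t := by
  induction t using PiTensorProduct.induction_on with
  | smul_tprod r v =>
    rw [map_smul, map_smul, map_smul, PiTensorProduct.map_tprod, wordCoord_tprod, wordCoord_tprod]
    simp [killCoord, hw]
  | add x y hx hy => rw [map_add, map_add, map_add, hx, hy]

/-- Every functorial retract of `V ↦ V^{⊗n}` is induced by an element of the group ring. -/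
theorem FunctorialRetract.exists_isInducedBy (M : FunctorialRetract R n) :
    ∃ e, M.IsInducedBy e := by
  classical
  let b : Fin n → Fin n → R := fun i => Pi.single i 1
  let t := M.proj (Fin n → R) (PiTensorProduct.tprod R b)
  have ht : ∀ w : Fin n → Fin n, ¬ Function.Surjective w → wordCoord R w t = 0 := by
    intro w hw
    obtain ⟨j, hj⟩ := not_forall.1 hw
    rw [← wordCoord_map_killCoord j (fun i hi => hj ⟨i, hi⟩)]
    have h1 := LinearMap.congr_fun (M.natural _ _ (killCoord R j)) (PiTensorProduct.tprod R b)
    have h2 : PiTensorProduct.map (fun _ => killCoord R j) (PiTensorProduct.tprod R b) = 0 := by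
      rw [PiTensorProduct.map_tprod]
      refine MultilinearMap.map_coord_zero _ j ?_
      funext i
      by_cases hi : i = j <;> simp [killCoord, b, hi]
    change PiTensorProduct.map (fun _ => killCoord R j) t = _ at h1
    rw [h1]
    change wordCoord R w (M.proj _ (PiTensorProduct.map _ _)) = 0
    rw [h2, map_zero, map_zero]
  have hsum : t = ∑ τ : Equiv.Perm (Fin n), wordCoord R τ.symm t •
      PiTensorProduct.tprod R fun i => b (τ.symm i) := by
    conv_lhs => rw [sum_wordCoord t]
    symm
    refine Finset.sum_of_injOn (fun τ : Equiv.Perm (Fin n) => (τ.symm : Fin n → Fin n)) ?_ ?_ ?_ ?_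
    · intro τ _ τ' _ h
      exact Equiv.symm_bijective.injective (DFunLike.coe_injective h)
    · simp
    · intro w _ hw
      rw [ht w, zero_smul]
      intro hs
      refine hw ⟨(Equiv.ofBijective w (Finite.surjective_iff_bijective.1 hs)).symm, by simp, ?_⟩
      rfl
    · intro τ _
      rfl
  refine ⟨MonoidAlgebra.ofCoeff (Finsupp.equivFunOnFinite.symm fun τ => wordCoord R τ.symm t),
    fun V _ _ => PiTensorProduct.ext (MultilinearMap.ext fun v => ?_)⟩
  let f : (Fin n → R) →ₗ[R] V := Fintype.linearCombination R v
  have hf : ∀ i, f (b i) = v i := fun i => by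
    rw [Fintype.linearCombination_apply_single, one_smul]
  have h1 := LinearMap.congr_fun (M.natural _ _ f) (PiTensorProduct.tprod R b)
  change PiTensorProduct.map (fun _ => f) t = M.proj V (PiTensorProduct.map (fun _ => f) _) at h1
  rw [PiTensorProduct.map_tprod] at h1
  simp only [hf] at h1
  change M.proj V (PiTensorProduct.tprod R v) = _
  rw [← h1]
  conv_lhs => rw [hsum]
  simp only [map_sum, map_smul, PiTensorProduct.map_tprod, hf]
  rw [LinearMap.compMultilinearMap_apply, LinearMap.sum_apply]
  refine Finset.sum_congr rfl fun τ _ => ?_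
  rw [LinearMap.smul_apply]
  exact congrArg _ (PiTensorProduct.reindex_tprod (R := R) (s := fun _ => V) τ v).symm

/-- An element that induces a retract containing the bottom cell has augmentation one. -/
theorem FunctorialRetract.sum_coeff_eq_one {M : FunctorialRetract R n} (hM : M.ContainsBottomCell)
    {e : MonoidAlgebra R (Equiv.Perm (Fin n))} (he : M.IsInducedBy e) :
    ∑ τ, e.coeff τ = 1 := by
  have h := hM R 1
  rw [he R, LinearMap.sum_apply] at h
  have h2 := congrArg (PiTensorProduct.lift (MultilinearMap.mkPiAlgebra R (Fin n) R)) h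
  rw [map_sum, PiTensorProduct.lift.tprod] at h2
  have h3 : ∀ τ : Equiv.Perm (Fin n), PiTensorProduct.lift (MultilinearMap.mkPiAlgebra R (Fin n) R)
      ((e.coeff τ • (PiTensorProduct.reindex R (fun _ : Fin n => R) τ).toLinearMap)
        (PiTensorProduct.tprod R fun _ => 1)) = e.coeff τ := fun τ => by
    rw [LinearMap.smul_apply, map_smul]
    have := PiTensorProduct.reindex_tprod (R := R) (s := fun _ => R) τ (fun _ => 1)
    refine (congrArg (fun z => e.coeff τ •
      PiTensorProduct.lift (MultilinearMap.mkPiAlgebra R (Fin n) R) z) this).trans ?_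
    rw [PiTensorProduct.lift.tprod]
    simp
  rw [Finset.sum_congr rfl fun τ _ => h3 τ] at h2
  simpa using h2

end Natural

/-! ### Cubes, boxes and lifting -/

section Box

variable {T : Type u} [TopologicalSpace T] {T' : Type v} [TopologicalSpace T'] {F : Type w}
  [TopologicalSpace F]

/-- The part `T × {0} ∪ S × I` of the prism `T × I`. -/
def prismBox (S : Set T) : Set (T × I) := {z | z.2 = 0 ∨ z.1 ∈ S}

/-- The part `T × {0, 1} ∪ S × I` of the prism `T × I`. -/
def prismBoundary (S : Set T) : Set (T × I) := {z | z.1 ∈ S ∨ z.2 = 0 ∨ z.2 = 1}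

/-- The prism `T × I` is a strong deformation retract of itself onto `T × {0} ∪ S × I`, along tracks
whose length is measured by the function `φ`. -/
structure IsBoxPair (S : Set T) : Prop where
  isClosed : IsClosed S
  exists_deformation : ∃ (D : (T × I) × I → T × I) (φ : T × I → I), Continuous D ∧ Continuous φ ∧
    (∀ z, D (z, 0) ∈ prismBox S) ∧ (∀ z, D (z, φ z) = z) ∧ ∀ z ∈ prismBox S, φ z = 0

theorem IsBoxPair.preimage {S : Set T} (hS : IsBoxPair S) (h : T' ≃ₜ T) : IsBoxPair (h ⁻¹' S) := by
  obtain ⟨D, φ, cD, cφ, h0, h1, h2⟩ := hS.exists_deformation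
  refine ⟨hS.isClosed.preimage h.continuous,
    fun q => (h.symm (D ((h q.1.1, q.1.2), q.2)).1, (D ((h q.1.1, q.1.2), q.2)).2),
    fun z => φ (h z.1, z.2), by fun_prop, by fun_prop, ?_, ?_, ?_⟩
  · intro z
    simpa [prismBox] using h0 (h z.1, z.2)
  · intro z
    simp [h1]
  · intro z hz
    exact h2 _ hz

/-- The unit cube as a part of the cube `[-1,1]^n`. -/
def centred {n : ℕ} (x : Fin n → I) : Fin n → ℝ := fun i => 2 * (x i : ℝ) - 1

theorem continuous_centred {n : ℕ} : Continuous (centred (n := n)) := by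
  unfold centred; fun_prop

theorem norm_centred_le {n : ℕ} (x : Fin n → I) : ‖centred x‖ ≤ 1 := by
  refine (pi_norm_le_iff_of_nonneg zero_le_one).2 fun i => ?_
  have := (x i).2.1
  have := (x i).2.2
  rw [Real.norm_eq_abs, centred, abs_le]
  constructor <;> linarith

theorem norm_centred_eq_one {n : ℕ} {x : Fin n → I} (hx : x ∈ Cube.boundary (Fin n)) :
    ‖centred x‖ = 1 := by
  obtain ⟨i, hi⟩ := hx
  refine le_antisymm (norm_centred_le x) (le_trans ?_ (norm_le_pi_norm (centred x) i))
  rcases hi with hi | hi <;> simp [centred, hi]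
  norm_num

theorem mem_boundary_of_norm_centred {n : ℕ} {x : Fin n → I} (h : ‖centred x‖ = 1) :
    x ∈ Cube.boundary (Fin n) := by
  by_contra hx
  refine absurd h (ne_of_lt ((pi_norm_lt_iff zero_lt_one).2 fun i => ?_))
  have h0 : x i ≠ 0 := fun h => hx ⟨i, .inl h⟩
  have h1 : x i ≠ 1 := fun h => hx ⟨i, .inr h⟩
  have a : (0 : ℝ) < x i := unitInterval.pos_iff_ne_zero.2 h0
  have b : (x i : ℝ) < 1 := unitInterval.lt_one_iff_ne_one.2 h1
  rw [Real.norm_eq_abs, centred, abs_lt]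
  constructor <;> linarith

theorem isClosed_cubeBoundary (n : ℕ) : IsClosed (Cube.boundary (Fin n)) := by
  have : Cube.boundary (Fin n) = {x | ‖centred x‖ = 1} :=
    Set.ext fun x => ⟨norm_centred_eq_one, mem_boundary_of_norm_centred⟩
  rw [this]
  have := continuous_centred (n := n)
  exact isClosed_eq (by fun_prop) continuous_const

/-- Radial projection from a point above the prism shows that cubes are box pairs. -/
theorem isBoxPair_cube (n : ℕ) : IsBoxPair (Cube.boundary (Fin n)) := by
  have cc := continuous_centred (n := n)
  let m : (Fin n → I) × I → ℝ := fun z => max ‖centred z.1‖ (1 - (z.2 : ℝ) / 2)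
  have cm : Continuous m := by fun_prop
  have m1 : ∀ z, m z ≤ 1 := fun z => max_le (norm_centred_le _) (by have := z.2.2.1; linarith)
  have m0 : ∀ z, 0 < m z := fun z => lt_max_of_lt_right (by have := z.2.2.2; linarith)
  have mJ : ∀ z ∈ prismBox (Cube.boundary (Fin n)), m z = 1 := by
    rintro z (hz | hz)
    · refine le_antisymm (m1 z) (le_max_of_le_right ?_)
      rw [hz]; simp
    · exact le_antisymm (m1 z) (le_max_of_le_left (norm_centred_eq_one hz).ge)
  let μ : ((Fin n → I) × I) × I → ℝ := fun q => min 1 (m q.1 + q.2)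
  have cμ : Continuous μ := by fun_prop
  have μ0 : ∀ q, μ q ≠ 0 := fun q =>
    (lt_min one_pos (add_pos_of_pos_of_nonneg (m0 _) q.2.2.1)).ne'
  let P : ℝ → I := Set.projIcc 0 1 zero_le_one
  have cP : Continuous P := continuous_projIcc
  have hP : ∀ t : I, P t = t := fun t => Set.projIcc_val _ t
  have P0 : P 0 = 0 := hP 0
  have P1 : P 1 = 1 := hP 1
  refine ⟨isClosed_cubeBoundary n, fun q => (fun i => P (1 / 2 + ((q.1.1 i : ℝ) - 1 / 2) / μ q),
    P (2 - (2 - (q.1.2 : ℝ)) / μ q)), fun z => P (1 - m z), ?_, by fun_prop, ?_, ?_, ?_⟩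
  · refine Continuous.prodMk (continuous_pi fun i => cP.comp ?_) (cP.comp ?_)
    · exact continuous_const.add (Continuous.div (by fun_prop) cμ μ0)
    · exact continuous_const.sub (Continuous.div (by fun_prop) cμ μ0)
  · intro z
    have hμ : μ (z, 0) = m z := by simp [μ, m1]
    rcases le_total ‖centred z.1‖ (1 - (z.2 : ℝ) / 2) with h | h
    · left
      have hm : m z = 1 - (z.2 : ℝ) / 2 := max_eq_right h
      have h0 := (m0 z).ne'
      change P (2 - (2 - (z.2 : ℝ)) / μ (z, 0)) = 0
      rw [hμ]
      have : (2 : ℝ) - (2 - (z.2 : ℝ)) / m z = 0 := by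
        field_simp
        rw [hm]; ring
      rw [this, P0]
    · right
      have hm : m z = ‖centred z.1‖ := max_eq_left h
      have h0 := (m0 z).ne'
      obtain ⟨i, hi⟩ : ∃ i, m z ≤ |centred z.1 i| := by
        by_contra! hlt
        exact absurd hm (ne_of_gt ((pi_norm_lt_iff (m0 z)).2 hlt))
      have hi' : |centred z.1 i| = m z :=
        le_antisymm ((norm_le_pi_norm (centred z.1) i).trans hm.ge) hi
      refine ⟨i, ?_⟩
      change P (1 / 2 + ((z.1 i : ℝ) - 1 / 2) / μ (z, 0)) = 0 ∨
        P (1 / 2 + ((z.1 i : ℝ) - 1 / 2) / μ (z, 0)) = 1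
      rw [hμ]
      rcases (abs_eq (m0 z).le).1 hi' with h | h
      · right
        have : (1 : ℝ) / 2 + ((z.1 i : ℝ) - 1 / 2) / m z = 1 := by
          have : (z.1 i : ℝ) - 1 / 2 = m z / 2 := by rw [← h, centred]; ring
          rw [this]; field_simp; norm_num
        rw [this, P1]
      · left
        have : (1 : ℝ) / 2 + ((z.1 i : ℝ) - 1 / 2) / m z = 0 := by
          have : (z.1 i : ℝ) - 1 / 2 = - m z / 2 := by rw [← h, centred]; ring
          rw [this]; field_simp; norm_num
        rw [this, P0]
  · intro z
    have h1 : ((P (1 - m z) : I) : ℝ) = 1 - m z := by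
      have := hP ⟨1 - m z, by linarith [m1 z], by linarith [m0 z]⟩
      exact congrArg Subtype.val this
    have hμ : μ (z, P (1 - m z)) = 1 := by
      change min 1 (m z + (P (1 - m z) : ℝ)) = 1
      rw [h1]; simp
    refine Prod.ext (funext fun i => ?_) ?_
    · change P (1 / 2 + ((z.1 i : ℝ) - 1 / 2) / μ (z, P (1 - m z))) = z.1 i
      rw [hμ, div_one, add_sub_cancel, hP]
    · change P (2 - (2 - (z.2 : ℝ)) / μ (z, P (1 - m z))) = z.2
      rw [hμ, div_one, sub_sub_cancel, hP]
  · intro z hz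
    change P (1 - m z) = 0
    rw [mJ z hz, sub_self, P0]

theorem IsBoxPair.extend {S : Set T} (hS : IsBoxPair S) {e : T × I → F}
    (he : ContinuousOn e (prismBox S)) :
    ∃ L : T × I → F, Continuous L ∧ ∀ z ∈ prismBox S, L z = e z := by
  obtain ⟨D, φ, cD, cφ, h0, h1, h2⟩ := hS.exists_deformation
  refine ⟨fun z => e (D (z, 0)), he.comp_continuous (by fun_prop) h0, fun z hz => ?_⟩
  have := h1 z
  rw [h2 z hz] at this
  exact congrArg e this

open Classical in
/-- A map on `T × {0}` and a map on `S × I` fit together. -/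
theorem continuousOn_prismBox {S : Set T} (hS : IsClosed S) {g : T → F} {Q : T × I → F}
    (hg : Continuous g) (hQ : ContinuousOn Q (Prod.fst ⁻¹' S)) (h : ∀ x ∈ S, Q (x, 0) = g x) :
    ContinuousOn (fun z : T × I => if z.1 ∈ S then Q z else g z.1) (prismBox S) := by
  have h1 : prismBox S = {z : T × I | z.2 = 0} ∪ Prod.fst ⁻¹' S := rfl
  rw [h1]
  refine ContinuousOn.union_of_isClosed ?_ ?_ (isClosed_eq continuous_snd continuous_const)
    (hS.preimage continuous_fst)
  · refine (hg.comp continuous_fst).continuousOn.congr fun z hz => ?_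
    split_ifs with hzS
    · have : z = (z.1, 0) := Prod.ext rfl hz
      rw [this, h _ hzS]
      rfl
    · rfl
  · refine hQ.congr fun z hz => if_pos hz

theorem IsBoxPair.extend_of_homotopic {S : Set T} (hS : IsBoxPair S) {g : T → F} {Q : T × I → F}
    (hg : Continuous g) (hQ : ContinuousOn Q (Prod.fst ⁻¹' S)) (h : ∀ x ∈ S, Q (x, 0) = g x) :
    ∃ L : T × I → F, Continuous L ∧ (∀ x, L (x, 0) = g x) ∧ ∀ x ∈ S, ∀ t, L (x, t) = Q (x, t) := by
  classical
  obtain ⟨L, cL, hL⟩ := hS.extend (continuousOn_prismBox hS.isClosed hg hQ h)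
  refine ⟨L, cL, fun x => ?_, fun x hx t => ?_⟩
  · rw [hL (x, 0) (.inl rfl)]
    dsimp only
    split_ifs with hx
    · exact h x hx
    · rfl
  · rw [hL (x, t) (.inr hx)]
    exact if_pos hx

/-- Maps out of a contractible space into a path component are null homotopic. -/
theorem exists_homotopy_const {m : T × I → T} (cm : Continuous m) (x₀ : T) (m1 : ∀ x, m (x, 1) = x)
    (m0 : ∀ x, m (x, 0) = x₀) {f : T → F} (hf : Continuous f) {c : F} (hc : Joined c (f x₀)) :
    ∃ H : T × I → F, Continuous H ∧ (∀ x, H (x, 0) = c) ∧ ∀ x, H (x, 1) = f x := by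
  obtain ⟨γ⟩ := hc
  have cl := continuous_low
  have ch := continuous_high
  refine ⟨fun z => if (z.2 : ℝ) ≤ 1 / 2 then γ (low z.2) else f (m (z.1, high z.2)), ?_, ?_, ?_⟩
  · refine Continuous.if_le (by fun_prop) (by fun_prop) (by fun_prop) (by fun_prop) fun z hz => ?_
    rw [low_eq_one hz.ge, high_eq_zero hz.le, m0, γ.target]
  · intro x
    simp [low_zero]
  · intro x
    dsimp only
    rw [if_neg (by norm_num), high_one, m1]

/-- The contraction of a cube. -/
def cubeScale {n : ℕ} (q : (Fin n → I) × I) : Fin n → I := fun i => q.2 * q.1 i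

theorem continuous_cubeScale {n : ℕ} : Continuous (cubeScale (n := n)) := by
  unfold cubeScale; fun_prop

theorem cubeScale_one {n : ℕ} (x : Fin n → I) : cubeScale (x, 1) = x := by
  funext i; simp [cubeScale]

theorem cubeScale_zero {n : ℕ} (x : Fin n → I) : cubeScale (x, 0) = 0 := by
  funext i; simp [cubeScale]

/-- All the generalized loops of `F` at `x₀` are null homotopic. -/
def NullLoops (F : Type w) [TopologicalSpace F] (x₀ : F) : Prop :=
  ∀ (n : ℕ) (l : (Fin n → I) → F), Continuous l → (∀ x ∈ Cube.boundary (Fin n), l x = x₀) →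
    ∃ N : (Fin n → I) × I → F, Continuous N ∧ (∀ x, N (x, 0) = x₀) ∧ (∀ x, N (x, 1) = l x) ∧
      ∀ x ∈ Cube.boundary (Fin n), ∀ t, N (x, t) = x₀

theorem NullLoops.joined {x₀ : F} (h : NullLoops F x₀) (x : F) : Joined x₀ x := by
  obtain ⟨N, cN, h0, h1, -⟩ := h 0 (fun _ => x) continuous_const (fun y ⟨i, _⟩ => i.elim0)
  exact ⟨⟨⟨fun t => N (0, t), by fun_prop⟩, h0 0, h1 0⟩⟩

/-- The last coordinate of a cube split off. -/
def cubeSplit (n : ℕ) : (Fin (n + 1) → I) ≃ₜ (Fin n → I) × I where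
  toFun x := (Fin.tail x, x 0)
  invFun q := Fin.cons q.2 q.1
  left_inv x := Fin.cons_self_tail x
  right_inv q := by simp
  continuous_toFun := by unfold Fin.tail; fun_prop
  continuous_invFun := by fun_prop

theorem cubeSplit_preimage (n : ℕ) :
    cubeSplit n ⁻¹' prismBoundary (Cube.boundary (Fin n)) = Cube.boundary (Fin (n + 1)) := by
  ext x
  change ((∃ i : Fin n, x i.succ = 0 ∨ x i.succ = 1) ∨ (x 0 = 0 ∨ x 0 = 1)) ↔
    ∃ i, x i = 0 ∨ x i = 1
  rw [Fin.exists_fin_succ]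
  exact or_comm

theorem isBoxPair_prism (n : ℕ) : IsBoxPair (prismBoundary (Cube.boundary (Fin n))) := by
  have := (isBoxPair_cube (n + 1)).preimage (cubeSplit n).symm
  rwa [← cubeSplit_preimage, ← Set.preimage_comp, Homeomorph.self_comp_symm, Set.preimage_id] at this

theorem NullLoops.fill_prism {x₀ : F} (h : NullLoops F x₀) (n : ℕ) {ψ : (Fin n → I) × I → F}
    (hψ : ContinuousOn ψ (prismBoundary (Cube.boundary (Fin n)))) :
    ∃ g : (Fin n → I) × I → F, Continuous g ∧ ∀ z ∈ prismBoundary (Cube.boundary (Fin n)),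
      g z = ψ z := by
  classical
  have hB := isBoxPair_cube n
  have sub : prismBox (Cube.boundary (Fin n)) ⊆ prismBoundary (Cube.boundary (Fin n)) := by
    rintro z (hz | hz)
    exacts [.inr (.inl hz), .inl hz]
  obtain ⟨ρ, cρ, hρ⟩ := hB.extend (hψ.mono sub)
  have cs := continuous_cubeScale (n := n)
  obtain ⟨G, cG, G0, G1⟩ := exists_homotopy_const (T := (Fin n → I) × I)
    (m := fun q => (cubeScale (q.1.1, q.2), q.2 * q.1.2)) (by fun_prop) (0, 0)
    (fun x => by simp [cubeScale_one]) (fun x => by simp [cubeScale_zero]) cρ (h.joined _)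
  have ctop : Continuous fun x : Fin n → I => ψ (x, 1) :=
    hψ.comp_continuous (by fun_prop) fun x => .inr (.inr rfl)
  obtain ⟨Q, cQ, Q0, QS⟩ := hB.extend_of_homotopic ctop (Q := fun z => G ((z.1, 1), unitInterval.symm z.2))
    (by fun_prop) (fun x hx => by
      dsimp only
      rw [unitInterval.symm_zero, G1, hρ _ (.inr hx)])
  obtain ⟨N, cN, N0, N1, NS⟩ := h n (fun x => Q (x, 1)) (by fun_prop) fun x hx => by
    rw [QS x hx, unitInterval.symm_one, G0]
  have hdecomp : Prod.fst ⁻¹' prismBoundary (Cube.boundary (Fin n)) =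
      {q : ((Fin n → I) × I) × I | q.1.2 = 1} ∪ Prod.fst ⁻¹' prismBox (Cube.boundary (Fin n)) := by
    ext q
    simp only [prismBoundary, prismBox, Set.mem_preimage, Set.mem_ofPred_eq, Set.mem_union]
    tauto
  have hbox : IsClosed (prismBox (Cube.boundary (Fin n))) :=
    (isClosed_eq continuous_snd continuous_const).union (hB.isClosed.preimage continuous_fst)
  obtain ⟨L, cL, -, hL⟩ := (isBoxPair_prism n).extend_of_homotopic cN
    (Q := fun q => if q.1.2 = 1 then Q (q.1.1, unitInterval.symm q.2) else G q) (by
      rw [hdecomp]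
      refine ContinuousOn.union_of_isClosed ?_ ?_ (isClosed_eq (by fun_prop) (by fun_prop))
        (hbox.preimage continuous_fst)
      · refine ContinuousOn.congr (f := fun q => Q (q.1.1, unitInterval.symm q.2)) (by fun_prop)
          fun q hq => if_pos (show q.1.2 = 1 from hq)
      · refine cG.continuousOn.congr fun q hq => ?_
        split_ifs with h1
        · rcases hq with hq | hq
          · exact absurd (hq.symm.trans h1) zero_ne_one
          · rw [QS _ hq, unitInterval.symm_symm, ← h1]
        · rfl) (by
      rintro ⟨x, t⟩ hz
      dsimp only
      split_ifs with h1
      · rw [h1, unitInterval.symm_zero, N1]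
      · rw [G0]
        rcases hz with hz | hz | hz
        · exact (NS x hz t).symm
        · exact (hz ▸ N0 x).symm
        · exact absurd hz h1)
  refine ⟨fun z => L (z, 1), by fun_prop, fun z hz => ?_⟩
  refine (hL z hz 1).trans ?_
  dsimp only
  split_ifs with h1
  · rw [unitInterval.symm_one, Q0, ← h1]
  · rw [G1, hρ]
    rcases hz with hz | hz | hz
    exacts [.inr hz, .inl hz, absurd hz h1]

/-- If all generalized loops are null homotopic, then all maps from boundaries of cubes extend. -/
theorem NullLoops.fill {x₀ : F} (h : NullLoops F x₀) (n : ℕ) {ψ : (Fin n → I) → F}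
    (hψ : ContinuousOn ψ (Cube.boundary (Fin n))) :
    ∃ g : (Fin n → I) → F, Continuous g ∧ ∀ x ∈ Cube.boundary (Fin n), g x = ψ x := by
  cases n with
  | zero => exact ⟨fun _ => x₀, continuous_const, fun x ⟨i, _⟩ => i.elim0⟩
  | succ n =>
    rw [← cubeSplit_preimage] at hψ ⊢
    obtain ⟨g, cg, hg⟩ := h.fill_prism n (ψ := ψ ∘ (cubeSplit n).symm)
      (hψ.comp (cubeSplit n).symm.continuous.continuousOn fun z hz => by simpa using hz)
    refine ⟨fun x => g (cubeSplit n x), cg.comp (cubeSplit n).continuous, fun x hx => ?_⟩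
    refine (hg _ hx).trans ?_
    simp

end Box

section Lifting

variable {E : Type v} [TopologicalSpace E] {B : Type w} [TopologicalSpace B]

/-- The homotopy lifting property. -/
def HasHLP (p : E → B) : Prop :=
  ∀ (T : Type) [TopologicalSpace T] (e : T → E) (H : T × I → B), Continuous e → Continuous H →
    (∀ x, H (x, 0) = p (e x)) →
    ∃ L : T × I → E, Continuous L ∧ (∀ x, L (x, 0) = e x) ∧ ∀ z, p (L z) = H z

/-- The right lifting property of `p` with respect to the inclusion of `S`. -/
def HasRLP (p : E → B) {T : Type} [TopologicalSpace T] (S : Set T) : Prop :=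
  ∀ (f : T → B) (ψ : T → E), Continuous f → ContinuousOn ψ S → (∀ x ∈ S, p (ψ x) = f x) →
    ∃ g : T → E, Continuous g ∧ (∀ x, p (g x) = f x) ∧ ∀ x ∈ S, g x = ψ x

variable {p : E → B} {T : Type} [TopologicalSpace T] {S : Set T}

open Classical in
theorem HasHLP.on_subset (hp : HasHLP p) {e : T → E} {H : T × I → B} (he : ContinuousOn e S)
    (hH : Continuous H) (h : ∀ x ∈ S, H (x, 0) = p (e x)) :
    ∃ L : T × I → E, ContinuousOn L (Prod.fst ⁻¹' S) ∧ (∀ x ∈ S, L (x, 0) = e x) ∧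
      ∀ x ∈ S, ∀ t, p (L (x, t)) = H (x, t) := by
  obtain ⟨L, cL, L0, L1⟩ := hp S (S.domRestrict e) (fun z => H (z.1, z.2))
    (continuousOn_iff_continuous_domRestrict.1 he) (by fun_prop) fun x => h x x.2
  refine ⟨fun z => if hz : z.1 ∈ S then L (⟨z.1, hz⟩, z.2) else e z.1, ?_, ?_, ?_⟩
  · rw [continuousOn_iff_continuous_domRestrict]
    have : Set.domRestrict (Prod.fst ⁻¹' S)
        (fun z : T × I => if hz : z.1 ∈ S then L (⟨z.1, hz⟩, z.2) else e z.1) =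
        fun z : ↥(Prod.fst ⁻¹' S : Set (T × I)) => L (⟨z.1.1, z.2⟩, z.1.2) :=
      funext fun z => dif_pos z.2
    rw [this]
    exact cL.comp (by fun_prop)
  · intro x hx
    dsimp only
    rw [dif_pos hx, L0]
    rfl
  · intro x hx t
    dsimp only
    rw [dif_pos hx, L1]

theorem HasHLP.rel (hp : HasHLP p) (hS : IsBoxPair S) {e : T × I → E} {H : T × I → B}
    (he : ContinuousOn e (prismBox S)) (hH : Continuous H) (h : ∀ z ∈ prismBox S, p (e z) = H z) :
    ∃ L : T × I → E, Continuous L ∧ (∀ z, p (L z) = H z) ∧ ∀ z ∈ prismBox S, L z = e z := by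
  obtain ⟨D, φ, cD, cφ, h0, h1, h2⟩ := hS.exists_deformation
  obtain ⟨L, cL, L0, L1⟩ := hp (T × I) (fun z => e (D (z, 0))) (fun q => H (D q))
    (he.comp_continuous (by fun_prop) h0) (by fun_prop) fun z => (h _ (h0 z)).symm
  refine ⟨fun z => L (z, φ z), by fun_prop, fun z => (L1 _).trans (congrArg H (h1 z)), fun z hz => ?_⟩
  have := h1 z
  rw [h2 z hz] at this
  dsimp only
  rw [h2 z hz, L0, this]

/-- A map with the homotopy lifting property has the right lifting property with respect to a
contractible pair if its fibre has. -/
theorem HasHLP.hasRLP (hp : HasHLP p) (hS : IsBoxPair S) (c : B)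
    (hc : ∀ f : T → B, Continuous f →
      ∃ H : T × I → B, Continuous H ∧ (∀ x, H (x, 0) = c) ∧ ∀ x, H (x, 1) = f x)
    (fill : ∀ ψ : T → E, ContinuousOn ψ S → (∀ x ∈ S, p (ψ x) = c) →
      ∃ g : T → E, Continuous g ∧ (∀ x, p (g x) = c) ∧ ∀ x ∈ S, g x = ψ x) : HasRLP p S := by
  classical
  intro f ψ hf hψ h
  obtain ⟨H, cH, H0, H1⟩ := hc f hf
  obtain ⟨L, cL, L0, L1⟩ := hp.on_subset hψ (H := fun z => H (z.1, unitInterval.symm z.2))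
    (by fun_prop) fun x hx => by
      dsimp only
      rw [unitInterval.symm_zero, H1, h x hx]
  obtain ⟨g, cg, gp, gS⟩ := fill (fun x => L (x, 1))
    (cL.comp (by fun_prop) fun x hx => hx) fun x hx => by
      rw [L1 x hx, unitInterval.symm_one, H0]
  have cbox := continuousOn_prismBox hS.isClosed cg
    (Q := fun z => L (z.1, unitInterval.symm z.2)) (cL.comp (by fun_prop) fun z hz => hz)
    fun x hx => by
      dsimp only
      rw [unitInterval.symm_zero, gS x hx]
  obtain ⟨M, cM, Mp, MS⟩ := hp.rel hS cbox cH (by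
    rintro ⟨x, t⟩ hz
    dsimp only
    split_ifs with hx
    · rw [L1 x hx, unitInterval.symm_symm]
    · rcases hz with hz | hz
      · dsimp only at hz
        rw [hz, H0, gp]
      · exact absurd hz hx)
  refine ⟨fun x => M (x, 1), by fun_prop, fun x => (Mp _).trans (H1 x), fun x hx => ?_⟩
  dsimp only
  rw [MS _ (.inr hx), if_pos hx, unitInterval.symm_one, L0 x hx]

end Lifting

/-! ### Lifting maps of relative CW complexes -/

section CellLifting

open Metric Set Topology.RelCWComplex

theorem HasRLP.extend_closedBall {E : Type v} [TopologicalSpace E] {B : Type w} [TopologicalSpace B]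
    {p : E → B} {n : ℕ} (hp : HasRLP p (Cube.boundary (Fin n))) {f : (Fin n → ℝ) → B}
    {ψ : (Fin n → ℝ) → E} (hf : ContinuousOn f (closedBall 0 1)) (hψ : ContinuousOn ψ (sphere 0 1))
    (h : ∀ x ∈ sphere (0 : Fin n → ℝ) 1, p (ψ x) = f x) :
    ∃ g : (Fin n → ℝ) → E, ContinuousOn g (closedBall 0 1) ∧
      (∀ x ∈ closedBall (0 : Fin n → ℝ) 1, p (g x) = f x) ∧ ∀ x ∈ sphere 0 1, g x = ψ x := by
  have hc := continuous_centred (n := n)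
  have hball : ∀ x : Fin n → I, centred x ∈ closedBall (0 : Fin n → ℝ) 1 := fun x =>
    mem_closedBall_zero_iff.2 (norm_centred_le x)
  have hsph : ∀ x ∈ Cube.boundary (Fin n), centred x ∈ sphere (0 : Fin n → ℝ) 1 := fun x hx =>
    mem_sphere_zero_iff_norm.2 (norm_centred_eq_one hx)
  obtain ⟨g, cg, gp, gψ⟩ := hp (fun x => f (centred x)) (fun x => ψ (centred x))
    (hf.comp_continuous hc hball) (hψ.comp hc.continuousOn hsph) fun x hx => h _ (hsph x hx)
  let q : (Fin n → ℝ) → Fin n → I := fun x i => projIcc 0 1 zero_le_one ((x i + 1) / 2)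
  have cq : Continuous q := by fun_prop
  have hq : ∀ x ∈ closedBall (0 : Fin n → ℝ) 1, centred (q x) = x := by
    intro x hx
    funext i
    have hi := (norm_le_pi_norm x i).trans (mem_closedBall_zero_iff.1 hx)
    rw [Real.norm_eq_abs, abs_le] at hi
    change 2 * (projIcc (0 : ℝ) 1 zero_le_one ((x i + 1) / 2) : ℝ) - 1 = x i
    rw [projIcc_of_mem zero_le_one (⟨by linarith, by linarith⟩ : (x i + 1) / 2 ∈ Icc 0 1)]
    ring
  refine ⟨fun x => g (q x), (cg.comp cq).continuousOn, fun x hx => ?_, fun x hx => ?_⟩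
  · dsimp only
    rw [gp, hq x hx]
  · have hx' := sphere_subset_closedBall hx
    dsimp only
    rw [gψ _ (mem_boundary_of_norm_centred _), hq x hx']
    rw [hq x hx', mem_sphere_zero_iff_norm.1 hx]

/-- Continuity on the image of a compact set can be tested on the compact set. -/
theorem continuousOn_image_of_isCompact {P : Type u} [TopologicalSpace P] [T2Space P] {K : Type v}
    [TopologicalSpace K] [T2Space K] {E : Type w} [TopologicalSpace E] {S : Set P}
    (hS : IsCompact S) {χ : P → K} (hχ : ContinuousOn χ S) {g : K → E}
    (hg : ContinuousOn (g ∘ χ) S) : ContinuousOn g (χ '' S) := by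
  rw [continuousOn_iff_isClosed]
  intro t ht
  have hc : IsClosed (S ∩ (g ∘ χ) ⁻¹' t) := hg.preimage_isClosed_of_isClosed hS.isClosed ht
  refine ⟨χ '' (S ∩ (g ∘ χ) ⁻¹' t), ((hS.of_isClosed_subset hc inter_subset_left).image_of_continuousOn
    (hχ.mono inter_subset_left)).isClosed, ?_⟩
  ext x
  constructor
  · rintro ⟨hx, y, hy, rfl⟩
    exact ⟨⟨y, ⟨hy, hx⟩, rfl⟩, y, hy, rfl⟩
  · rintro ⟨⟨y, ⟨hy, hy'⟩, rfl⟩, -⟩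
    exact ⟨hy', y, hy, rfl⟩

variable {K : Type u} [TopologicalSpace K] [T2Space K] {k₀ : K}
  [Topology.RelCWComplex (univ : Set K) {k₀}] {E : Type v} [TopologicalSpace E] {B : Type w}

/-- A lift, as a function, that is continuous on all cells of dimension less than `n`. -/
structure PartialLift (p : E → B) (f : K → B) (e₀ : E) (k₀ : K)
    [Topology.RelCWComplex (univ : Set K) {k₀}] (n : ℕ) (g : K → E) : Prop where
  lift : ∀ x, p (g x) = f x
  base : g k₀ = e₀
  cont : ∀ m < n, ∀ i : cell (univ : Set K) m, ContinuousOn (g ∘ map m i) (closedBall 0 1)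

theorem PartialLift.continuousOn_sphere {p : E → B} {f : K → B} {e₀ : E} {n : ℕ} {g : K → E}
    (hg : PartialLift p f e₀ k₀ n g) (i : cell (univ : Set K) n) :
    ContinuousOn (g ∘ map n i) (sphere 0 1) := by
  obtain ⟨J, hJ⟩ := mapsTo (C := (univ : Set K)) n i
  let ι := Σ m : Fin n, {j // j ∈ J m}
  have h1 : ContinuousOn g (⋃ q : ι, closedCell (C := (univ : Set K)) q.1 q.2.1) := by
    refine LocallyFinite.continuousOn_iUnion (locallyFinite_of_finite _)
      (fun q => isClosed_closedCell) fun q => ?_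
    exact continuousOn_image_of_isCompact (isCompact_closedBall 0 1) (continuousOn _ _)
      (hg.cont _ q.1.2 _)
  have h2 : ContinuousOn g ({k₀} ∪ ⋃ q : ι, closedCell (C := (univ : Set K)) q.1 q.2.1) :=
    (continuousOn_singleton _ _).union_of_isClosed h1 isClosed_singleton
      (isClosed_iUnion_of_finite fun q => isClosed_closedCell)
  refine h2.comp ((continuousOn n i).mono sphere_subset_closedBall) (hJ.mono_right ?_)
  refine union_subset_union_right _ ?_
  simp only [iUnion_subset_iff]
  intro m hm j hj
  exact subset_iUnion (fun q : ι => closedCell (C := (univ : Set K)) q.1 q.2.1) ⟨⟨m, hm⟩, ⟨j, hj⟩⟩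

theorem disjoint_closedCell_openCell {m n : ℕ} (h : m < n) (i : cell (univ : Set K) m)
    (j : cell (univ : Set K) n) : Disjoint (closedCell m i) (openCell n j) :=
  (disjoint_skeletonLT_openCell (n := ((m + 1 : ℕ) : ℕ∞)) (by exact_mod_cast h)).mono_left (by
    exact_mod_cast closedCell_subset_skeletonLT m i)

theorem PartialLift.exists_succ [TopologicalSpace B] {p : E → B}
    (hp : ∀ n, HasRLP p (Cube.boundary (Fin n)))
    {f : K → B} (hf : Continuous f) {e₀ : E} {n : ℕ} {g : K → E}
    (hg : PartialLift p f e₀ k₀ n g) : ∃ g', PartialLift p f e₀ k₀ (n + 1) g' ∧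
      ∀ x, (∀ i : cell (univ : Set K) n, x ∉ openCell n i) → g' x = g x := by
  classical
  choose h ch hlift hsph using fun i : cell (univ : Set K) n => (hp n).extend_closedBall
    (f := f ∘ map n i) (hf.comp_continuousOn (continuousOn n i)) (hg.continuousOn_sphere i)
    (fun x _ => hg.lift _)
  let g' : K → E := fun x => if hx : ∃ i : cell (univ : Set K) n, x ∈ openCell n i
    then h hx.choose ((map n hx.choose).symm x) else g x
  have eq1 : ∀ x, (∀ i : cell (univ : Set K) n, x ∉ openCell n i) → g' x = g x := fun x hx =>
    dif_neg fun ⟨i, hi⟩ => hx i hi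
  have eq2 : ∀ i : cell (univ : Set K) n, ∀ y ∈ ball (0 : Fin n → ℝ) 1,
      g' (map n i y) = h i y := by
    intro i y hy
    have hx : ∃ i' : cell (univ : Set K) n, map n i y ∈ openCell n i' := ⟨i, y, hy, rfl⟩
    have hi : hx.choose = i := by
      by_contra hne
      have hd := disjoint_openCell_of_ne (C := (univ : Set K)) (n := n) (m := n)
        (i := hx.choose) (j := i) (fun h => hne (by simpa using h))
      exact disjoint_left.1 hd hx.choose_spec ⟨y, hy, rfl⟩
    change (if hx : _ then _ else _) = _
    rw [dif_pos hx, hi, (map n i).left_inv (by rwa [source_eq])]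
  have eq3 : ∀ m < n, ∀ (i : cell (univ : Set K) m), ∀ x ∈ closedCell m i, g' x = g x :=
    fun m hm i x hx => eq1 x fun j hj => disjoint_left.1 (disjoint_closedCell_openCell hm i j) hx hj
  have eq4 : g' k₀ = g k₀ := eq1 _ fun i hi =>
    disjoint_left.1 (disjointBase (C := (univ : Set K)) n i) hi rfl
  have eq5 : ∀ i : cell (univ : Set K) n, ∀ y ∈ closedBall (0 : Fin n → ℝ) 1,
      g' (map n i y) = h i y := by
    intro i y hy
    rcases (ball_union_sphere (x := (0 : Fin n → ℝ)) (ε := 1)).ge hy with hy | hy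
    · exact eq2 i y hy
    · rw [hsph i y hy]
      obtain ⟨J, hJ⟩ := mapsTo (C := (univ : Set K)) n i
      rcases hJ hy with h0 | h0
      · rw [mem_singleton_iff.1 h0, eq4, Function.comp_apply, mem_singleton_iff.1 h0]
      · simp only [mem_iUnion] at h0
        obtain ⟨m, hm, j, -, hj⟩ := h0
        exact eq3 m hm j _ hj
  refine ⟨g', ⟨fun x => ?_, eq4.trans hg.base, fun m hm i => ?_⟩, eq1⟩
  · by_cases hx : ∃ i : cell (univ : Set K) n, x ∈ openCell n i
    · obtain ⟨i, y, hy, rfl⟩ := hx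
      rw [eq2 i y hy, hlift i y (ball_subset_closedBall hy)]
      rfl
    · rw [eq1 x (not_exists.1 hx), hg.lift]
  · rcases Nat.lt_succ_iff_lt_or_eq.1 hm with hm | rfl
    · refine (hg.cont m hm i).congr fun y hy => eq3 m hm i _ ⟨y, hy, rfl⟩
    · exact (ch i).congr fun y hy => eq5 i y hy

/-- Maps out of a CW complex relative to a point lift along a map with the right lifting property
for the boundary inclusions of all cubes. -/
theorem exists_lift_of_hasRLP [TopologicalSpace B] {p : E → B}
    (hp : ∀ n, HasRLP p (Cube.boundary (Fin n)))
    {f : K → B} (hf : Continuous f) {e₀ : E} (he : p e₀ = f k₀) :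
    ∃ g : K → E, Continuous g ∧ (∀ x, p (g x) = f x) ∧ g k₀ = e₀ := by
  classical
  have hsurj : ∀ b, ∃ e, p e = b := fun b => by
    obtain ⟨g, -, h, -⟩ := hp 0 (fun _ => b) (fun _ => e₀) continuous_const continuousOn_const
      fun x ⟨i, _⟩ => i.elim0
    exact ⟨g 0, h 0⟩
  choose r hr using hsurj
  have h0 : PartialLift p f e₀ k₀ 0 fun x => if x = k₀ then e₀ else r (f x) := by
    refine ⟨fun x => ?_, if_pos rfl, fun m hm => absurd hm (Nat.not_lt_zero m)⟩
    split_ifs with hx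
    · rw [he, hx]
    · exact hr _
  choose next hnext heq using fun (n : ℕ) (g : K → E) (hg : PartialLift p f e₀ k₀ n g) =>
    hg.exists_succ hp hf
  let s : ∀ n : ℕ, {g : K → E // PartialLift p f e₀ k₀ n g} := fun n =>
    Nat.rec ⟨_, h0⟩ (fun n g => ⟨next n g.1 g.2, hnext n g.1 g.2⟩) n
  have hs : ∀ n x, (∀ i : cell (univ : Set K) n, x ∉ openCell n i) →
      (s (n + 1)).1 x = (s n).1 x := fun n x hx => heq n (s n).1 (s n).2 x hx
  have hcell : ∀ m (i : cell (univ : Set K) m), ∀ x ∈ closedCell m i, ∀ n, m + 1 ≤ n →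
      (s n).1 x = (s (m + 1)).1 x := by
    intro m i x hx n hn
    induction n, hn using Nat.le_induction with
    | base => rfl
    | succ n hn ih =>
      rw [hs n x fun j hj => disjoint_left.1 (disjoint_closedCell_openCell hn i j) hx hj, ih]
  have hev : ∀ x, ∃ d, ∀ n, d ≤ n → (s n).1 x = (s d).1 x := by
    intro x
    have hx : x ∈ ({k₀} ∪ ⋃ (n : ℕ) (j : cell (univ : Set K) n), closedCell n j : Set K) := by
      rw [Topology.RelCWComplex.union]; trivial
    rcases hx with hx | hx
    · refine ⟨0, fun n _ => ?_⟩
      rw [mem_singleton_iff.1 hx, (s n).2.base, (s 0).2.base]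
    · simp only [mem_iUnion] at hx
      obtain ⟨m, i, hi⟩ := hx
      exact ⟨m + 1, hcell m i x hi⟩
  choose d hd using hev
  let g : K → E := fun x => (s (d x)).1 x
  have hg : ∀ m (i : cell (univ : Set K) m), ∀ x ∈ closedCell m i, g x = (s (m + 1)).1 x := by
    intro m i x hx
    rw [← hcell m i x hx _ (le_max_left (m + 1) (d x)), hd x _ (le_max_right (m + 1) (d x))]
  refine ⟨g, ?_, fun x => (s _).2.lift x, (s _).2.base⟩
  refine continuous_iff_isClosed.2 fun t ht => closed' (C := (univ : Set K)) _ (subset_univ _)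
    ⟨fun m i => ?_, ?_⟩
  · have h1 : ContinuousOn g (closedCell m i) :=
      (continuousOn_image_of_isCompact (isCompact_closedBall 0 1) (continuousOn m i)
        ((s (m + 1)).2.cont m (Nat.lt_succ_self m) i)).congr (hg m i)
    rw [inter_comm]
    exact h1.preimage_isClosed_of_isClosed isClosed_closedCell ht
  · exact ((finite_singleton k₀).subset inter_subset_right).isClosed

end CellLifting

/-! ### The mapping path space -/

section MapPath

variable {Z : Type u} [TopologicalSpace Z] {W : Type v} [TopologicalSpace W]

/-- The mapping path space of `u`: points `z` with a path that starts at `u z`. -/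
def MapPath (u : Z → W) : Type max u v := {q : Z × C(I, W) // q.2 0 = u q.1}

instance (u : Z → W) : TopologicalSpace (MapPath u) :=
  inferInstanceAs (TopologicalSpace {q : Z × C(I, W) // q.2 0 = u q.1})

namespace MapPath

variable {u : Z → W}

/-- The end point of the path. -/
def endpt (q : MapPath u) : W := q.1.2 1

theorem continuous_fst : Continuous fun q : MapPath u => q.1.1 :=
  Continuous.fst continuous_subtype_val

theorem continuous_snd : Continuous fun q : MapPath u => q.1.2 :=
  Continuous.snd continuous_subtype_val

theorem continuous_endpt : Continuous (endpt : MapPath u → W) := by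
  have := continuous_snd (u := u)
  unfold endpt
  fun_prop

/-- A map into the mapping path space from a family of points and paths. -/
theorem exists_family {T : Type w} [TopologicalSpace T] {z : T → Z} {γ : T × I → W}
    (hz : Continuous z) (hγ : Continuous γ) (h : ∀ x, γ (x, 0) = u (z x)) :
    ∃ L : T → MapPath u, Continuous L ∧ ∀ x, (L x).1.1 = z x ∧ ∀ t, (L x).1.2 t = γ (x, t) :=
  ⟨fun x => ⟨(z x, ContinuousMap.curry ⟨γ, hγ⟩ x), h x⟩,
    Continuous.subtype_mk (hz.prodMk (ContinuousMap.curry ⟨γ, hγ⟩).continuous) _,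
    fun _ => ⟨rfl, fun _ => rfl⟩⟩

theorem ext {Z : Type u} {u : Z → W} {q q' : MapPath u} (h : q.1.1 = q'.1.1)
    (h' : ∀ t, q.1.2 t = q'.1.2 t) : q = q' :=
  Subtype.ext (Prod.ext h (ContinuousMap.ext h'))

theorem hasHLP (u : Z → W) : HasHLP (endpt : MapPath u → W) := by
  intro T _ e H he hH h
  have c1 := continuous_fst.comp he
  have c2 := continuous_snd.comp he
  let P : ℝ → I := Set.projIcc 0 1 zero_le_one
  have cP : Continuous P := continuous_projIcc
  have hP : ∀ t : I, P t = t := fun t => Set.projIcc_val _ t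
  let γ : (T × I) × I → W := fun q => if (q.2 : ℝ) * (1 + q.1.2) ≤ 1
    then (e q.1.1).1.2 (P (q.2 * (1 + q.1.2))) else H (q.1.1, P (q.2 * (1 + q.1.2) - 1))
  have hγ : Continuous γ := by
    refine Continuous.if_le ?_ (by fun_prop) (by fun_prop) (by fun_prop) fun q hq => ?_
    · have c3 : Continuous fun q : (T × I) × I => (e q.1.1).1.2 := c2.comp (by fun_prop)
      fun_prop
    · rw [hq, sub_self, show P 1 = 1 from hP 1, show P 0 = 0 from hP 0, h]
      rfl
  obtain ⟨L, cL, hL⟩ := exists_family (u := u) (T := T × I) (z := fun q => (e q.1).1.1)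
    (c1.comp (by fun_prop)) hγ fun x => by
      have : P 0 = 0 := hP 0
      simp only [γ, Set.Icc.coe_zero, zero_mul, zero_le_one, if_true, this]
      exact (e x.1).2
  refine ⟨L, cL, fun x => ext (hL _).1 fun t => ?_, fun z => ?_⟩
  · rw [(hL _).2]
    have := t.2.2
    simp only [γ, Set.Icc.coe_zero, add_zero, mul_one, this, if_true, hP]
  · rw [endpt, (hL _).2]
    simp only [γ, Set.Icc.coe_one, one_mul]
    split_ifs with h1
    · have h2 : (z.2 : ℝ) = 0 := le_antisymm (by linarith) z.2.2.1
      have h3 : z.2 = 0 := Subtype.ext h2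
      rw [h2, add_zero, show P 1 = 1 from hP 1]
      rw [show z = (z.1, 0) from Prod.ext rfl h3, h]
      rfl
    · rw [add_sub_cancel_left, hP]

end MapPath

/-- The homotopy fibre of `u` over `w`. -/
def HoFiber (u : Z → W) (w : W) : Type max u v := {q : MapPath u // q.endpt = w}

instance (u : Z → W) (w : W) : TopologicalSpace (HoFiber u w) :=
  inferInstanceAs (TopologicalSpace {q : MapPath u // q.endpt = w})

/-- If the spheres in the homotopy fibre over `c` are fillable and the base is path connected, then
the path fibration of `u` has the right lifting property for boundaries of cubes. -/
theorem MapPath.hasRLP (u : Z → W) (c : W) (hc : ∀ w, Joined c w) {x₀ : HoFiber u c}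
    (hF : NullLoops (HoFiber u c) x₀) (n : ℕ) :
    HasRLP (endpt : MapPath u → W) (Cube.boundary (Fin n)) := by
  classical
  refine (MapPath.hasHLP u).hasRLP (isBoxPair_cube n) c (fun f hf => exists_homotopy_const
    continuous_cubeScale 0 cubeScale_one cubeScale_zero hf (hc _)) fun ψ hψ hc => ?_
  let ψ' : (Fin n → I) → HoFiber u c := fun x =>
    if h : (ψ x).endpt = c then ⟨ψ x, h⟩ else x₀
  have hψ' : ∀ x ∈ Cube.boundary (Fin n), (ψ' x).1 = ψ x := fun x hx =>
    congrArg Subtype.val (dif_pos (hc x hx))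
  have c' : ContinuousOn ψ' (Cube.boundary (Fin n)) :=
    Topology.IsInducing.subtypeVal.continuousOn_iff.2 (hψ.congr fun x hx => hψ' x hx)
  obtain ⟨g, cg, hg⟩ := hF.fill n c'
  refine ⟨fun x => (g x).1, continuous_subtype_val.comp cg, fun x => (g x).2, fun x hx => ?_⟩
  rw [← hψ' x hx, ← hg x hx]

/-- A point of the homotopy fibre of `u` is joined to the base point, if `u` is injective on path
components and surjective on fundamental groups at the base point. -/
theorem exists_path_hoFiber {u : Z → W} (hu : Continuous u) {z₀ : Z}
    (h0 : ∀ z, Joined (u z) (u z₀) → Joined z z₀)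
    (h1 : ∀ δ : Path (u z₀) (u z₀), ∃ ζ : Path z₀ z₀, (ζ.map hu).Homotopic δ)
    {z : Z} (γ : Path (u z) (u z₀)) :
    ∃ (ζ : I → Z) (Γ : I × I → W), Continuous ζ ∧ Continuous Γ ∧ ζ 0 = z₀ ∧ ζ 1 = z ∧
      (∀ s, Γ (s, 0) = u (ζ s)) ∧ (∀ s, Γ (s, 1) = u z₀) ∧ (∀ t, Γ (0, t) = u z₀) ∧
      ∀ t, Γ (1, t) = γ t := by
  obtain ⟨α⟩ := h0 z ⟨γ⟩
  obtain ⟨β, hβ⟩ := h1 ((α.map hu).symm.trans γ)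
  let ζ := α.trans β
  have hζ : (ζ.map hu).Homotopic γ := by
    have e : ζ.map hu = (α.map hu).trans (β.map hu) := Path.map_trans _ _ _
    rw [e]
    refine ((Path.Homotopic.refl _).hcomp hβ).trans ?_
    refine Path.Homotopic.trans ⟨(Path.Homotopy.transAssoc _ _ _).symm⟩ ?_
    refine Path.Homotopic.trans (Path.Homotopic.hcomp
      ⟨(Path.Homotopy.reflTransSymm (α.map hu)).symm⟩ (Path.Homotopic.refl γ)) ?_
    exact ⟨Path.Homotopy.reflTrans γ⟩
  obtain ⟨K⟩ := hζ
  have cl := continuous_low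
  have ch := continuous_high
  have k0 : ∀ s, K (s, 0) = u z := fun s => K.source s
  have k1 : ∀ s, K (s, 1) = u z₀ := fun s => K.target s
  have l1 : ∀ {s : I}, ¬ (s : ℝ) ≤ 1 / 2 → low s = 1 := fun h => low_eq_one (by linarith)
  refine ⟨fun s => ζ (unitInterval.symm (low s)), fun q => if (q.1 : ℝ) ≤ 1 / 2
    then u (ζ (max (unitInterval.symm (low q.1)) q.2)) else K (high q.1, q.2),
    by fun_prop, ?_, ?_, ?_, ?_, ?_, ?_, ?_⟩
  · refine Continuous.if_le (hu.comp (ζ.continuous.comp (by fun_prop))) (by fun_prop)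
      (by fun_prop) (by fun_prop) fun q hq => ?_
    rw [low_eq_one hq.ge, high_eq_zero hq.le, unitInterval.symm_one]
    rw [show max 0 q.2 = q.2 from max_eq_right unitInterval.nonneg']
    exact (K.apply_zero q.2).symm
  · simp [low_zero]
  · simp [low_eq_one (t := 1) (by norm_num)]
  · intro s
    dsimp only
    split_ifs with hs
    · rw [max_eq_left unitInterval.nonneg']
    · rw [k0, l1 hs, unitInterval.symm_one, ζ.source]
  · intro s
    dsimp only
    split_ifs with hs
    · rw [max_eq_right unitInterval.le_one', ζ.target]
    · rw [k1]
  · intro t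
    have : max 1 t = 1 := max_eq_left unitInterval.le_one'
    simp [low_zero, this]
  · intro t
    dsimp only
    rw [if_neg (by norm_num), high_one]
    exact K.apply_one t

end MapPath

/-! ### Powers of generalized loops -/

section Powers

variable {Y : Type u} [TopologicalSpace Y] {y₀ : Y} {k : ℕ}

/-- A continuous family of generalized loops. -/
theorem continuous_genLoop_of_family {T : Type v} [TopologicalSpace T]
    {L : T → GenLoop (Fin k) Y y₀} (h : Continuous fun q : T × (Fin k → I) => L q.1 q.2) :
    Continuous L := by
  refine Continuous.subtype_mk (f := fun t => (L t).1) ?_ _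
  exact ContinuousMap.continuous_of_continuous_uncurry _ h

theorem joined_iff_homotopic {f g : GenLoop (Fin k) Y y₀} : Joined f g ↔ GenLoop.Homotopic f g := by
  constructor
  · rintro ⟨γ⟩
    refine ⟨⟨⟨⟨fun q => γ q.1 q.2, by fun_prop⟩, fun x => ?_, fun x => ?_⟩, fun t x hx => ?_⟩⟩
    · exact congrArg (fun l : GenLoop (Fin k) Y y₀ => l x) γ.source
    · exact congrArg (fun l : GenLoop (Fin k) Y y₀ => l x) γ.target
    · exact ((γ t).2 x hx).trans (f.2 x hx).symm
  · rintro ⟨H⟩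
    refine ⟨⟨⟨fun t => ⟨⟨fun x => H (t, x), by fun_prop⟩, fun x hx => ?_⟩, ?_⟩, ?_, ?_⟩⟩
    · exact (H.eq_fst t hx).trans (f.2 x hx)
    · refine continuous_genLoop_of_family ?_
      exact H.continuous
    · exact GenLoop.ext _ _ fun x => H.apply_zero x
    · exact GenLoop.ext _ _ fun x => H.apply_one x

theorem genLoop_update_endpoint (l : GenLoop (Fin k) Y y₀) (i : Fin k) (x : Fin k → I) {t : I}
    (ht : t = 0 ∨ t = 1) : l (Function.update x i t) = y₀ :=
  l.2 _ ⟨i, by simpa using ht⟩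

theorem continuous_genLoop_wrap (i : Fin k) (N : ℕ) :
    Continuous fun q : GenLoop (Fin k) Y y₀ × (Fin k → I) =>
      q.1 (Function.update q.2 i (wrap N (q.2 i))) := by
  have := continuous_comp_wrap (T := GenLoop (Fin k) Y y₀ × (Fin k → I))
    (F := fun q => q.1.1 (Function.update q.1.2 i q.2)) (by fun_prop) (fun q => by
      dsimp only
      rw [genLoop_update_endpoint _ _ _ (.inl rfl), genLoop_update_endpoint _ _ _ (.inr rfl)]) N
  exact this.comp (by fun_prop : Continuous fun q : GenLoop (Fin k) Y y₀ × (Fin k → I) =>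
    (q, q.2 i))

/-- The power map on generalized loops, formed with the `i`-th coordinate. -/
def genWrap (i : Fin k) (N : ℕ) (l : GenLoop (Fin k) Y y₀) : GenLoop (Fin k) Y y₀ :=
  ⟨⟨fun x => l (Function.update x i (wrap N (x i))), (continuous_genLoop_wrap i N).comp
      (by fun_prop : Continuous fun x : Fin k → I => (l, x))⟩, by
    rintro x ⟨j, hj⟩
    change l _ = y₀
    by_cases hji : j = i
    · subst hji
      refine genLoop_update_endpoint _ _ _ (.inl ?_)
      rcases hj with hj | hj <;> rw [hj]
      exacts [wrap_zero N, wrap_one N]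
    · exact l.2 _ ⟨j, by simpa [Function.update_of_ne hji] using hj⟩⟩

theorem genWrap_apply (i : Fin k) (N : ℕ) (l : GenLoop (Fin k) Y y₀) (x : Fin k → I) :
    genWrap i N l x = l (Function.update x i (wrap N (x i))) := rfl

theorem continuous_genWrap (i : Fin k) (N : ℕ) :
    Continuous (genWrap i N : GenLoop (Fin k) Y y₀ → GenLoop (Fin k) Y y₀) :=
  continuous_genLoop_of_family (continuous_genLoop_wrap i N)

/-- The class of a generalized loop in the homotopy group. -/
def genCls (l : GenLoop (Fin k) Y y₀) : HomotopyGroup (Fin k) Y y₀ := Quotient.mk _ l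

theorem genCls_eq_iff {l l' : GenLoop (Fin k) Y y₀} :
    genCls l = genCls l' ↔ GenLoop.Homotopic l l' := Quotient.eq

theorem genCls_pow [Nonempty (Fin k)] (i : Fin k) (N : ℕ) (l : GenLoop (Fin k) Y y₀) :
    genCls l ^ N = genCls (genWrap i N l) := by
  induction N with
  | zero =>
    rw [pow_zero, HomotopyGroup.one_def]
    refine congrArg genCls ?_
    refine GenLoop.ext _ _ fun x => ?_
    rw [genWrap_apply, wrap, genLoop_update_endpoint _ _ _ (.inl rfl)]
    rfl
  | succ N ih =>
    rw [pow_succ, ih]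
    refine (HomotopyGroup.mul_spec (i := i)).trans ?_
    refine congrArg genCls ?_
    refine GenLoop.ext _ _ fun x => ?_
    rw [genWrap_apply, wrap]
    change (if (x i : ℝ) ≤ 1 / 2 then _ else _) = _
    split_ifs
    · rfl
    · rw [genWrap_apply, Function.update_self, Function.update_idem]
      rfl

end Powers

section Divisible

variable {Y : Type u} [TopologicalSpace Y] {y₀ : Y} {N : ℕ}

theorem joined_const_of_pow_injective {k : ℕ} [Nonempty (Fin k)] (i : Fin k)
    (h : Function.Injective fun g : HomotopyGroup (Fin k) Y y₀ => g ^ N)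
    (l : GenLoop (Fin k) Y y₀) (hl : Joined (genWrap i N l) (genWrap i N GenLoop.const)) :
    Joined l GenLoop.const := by
  rw [joined_iff_homotopic] at hl ⊢
  rw [← genCls_eq_iff, ← genCls_pow, ← genCls_pow] at hl
  exact genCls_eq_iff.1 (h hl)

theorem cons_mem_boundary {k : ℕ} {t : I} {x : Fin k → I}
    (h : (t = 0 ∨ t = 1) ∨ x ∈ Cube.boundary (Fin k)) :
    (Fin.cons t x : Fin (k + 1) → I) ∈ Cube.boundary (Fin (k + 1)) := by
  rcases h with h | ⟨i, hi⟩
  · exact ⟨0, h⟩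
  · exact ⟨i.succ, hi⟩

theorem exists_loop_of_pow_surjective {k : ℕ} (i : Fin k)
    (h : Function.Surjective fun g : HomotopyGroup (Fin (k + 1)) Y y₀ => g ^ N)
    (δ : Path (genWrap i N (GenLoop.const : GenLoop (Fin k) Y y₀)) (genWrap i N GenLoop.const)) :
    ∃ ζ : Path (GenLoop.const : GenLoop (Fin k) Y y₀) GenLoop.const,
      (ζ.map (continuous_genWrap i N)).Homotopic δ := by
  let θ : GenLoop (Fin (k + 1)) Y y₀ := ⟨⟨fun x => δ (x 0) (Fin.tail x), by
      unfold Fin.tail; fun_prop⟩, by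
    rintro x ⟨j, hj⟩
    change δ (x 0) (Fin.tail x) = y₀
    cases j using Fin.cases with
    | zero =>
      rcases hj with hj | hj
      · rw [hj, δ.source]; rfl
      · rw [hj, δ.target]; rfl
    | succ j => exact (δ (x 0)).2 _ ⟨j, hj⟩⟩
  obtain ⟨c, hc⟩ := h (genCls θ)
  obtain ⟨l, rfl⟩ : ∃ l, genCls l = c := Quotient.exists_rep c
  obtain ⟨H⟩ := genCls_eq_iff.1 ((genCls_pow i.succ N l).symm.trans hc)
  refine ⟨⟨⟨fun t => ⟨⟨fun x => l (Fin.cons t x), by fun_prop⟩, fun x hx =>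
    l.2 _ (cons_mem_boundary (.inr hx))⟩, continuous_genLoop_of_family ?_⟩, ?_, ?_⟩, ?_⟩
  · change Continuous fun q : I × (Fin k → I) => l (Fin.cons q.1 q.2)
    fun_prop
  · exact GenLoop.ext _ _ fun x => l.2 _ (cons_mem_boundary (.inl (.inl rfl)))
  · exact GenLoop.ext _ _ fun x => l.2 _ (cons_mem_boundary (.inl (.inr rfl)))
  · have hb : ∀ (s : I) (y : Fin (k + 1) → I), y ∈ Cube.boundary (Fin (k + 1)) → H (s, y) = y₀ :=
      fun s y hy => (H.eq_fst s hy).trans ((genWrap i.succ N l).2 y hy)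
    refine ⟨⟨⟨⟨fun q => ⟨⟨fun x => H (q.1, Fin.cons q.2 x), by fun_prop⟩, fun x hx =>
      hb _ _ (cons_mem_boundary (.inr hx))⟩, continuous_genLoop_of_family ?_⟩, ?_, ?_⟩, ?_⟩⟩
    · change Continuous fun q : (I × I) × (Fin k → I) => H (q.1.1, Fin.cons q.1.2 q.2)
      fun_prop
    · intro t
      refine GenLoop.ext _ _ fun x => (H.apply_zero _).trans ?_
      change l (Function.update (Fin.cons t x : Fin (k + 1) → I) i.succ _) =
        l (Fin.cons t (Function.update x i _))
      rw [← Fin.cons_update]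
      rfl
    · intro t
      refine GenLoop.ext _ _ fun x => (H.apply_one _).trans ?_
      rfl
    · rintro s t ht
      refine GenLoop.ext _ _ fun x => (hb _ _ (cons_mem_boundary (.inl ht))).trans ?_
      rcases ht with rfl | rfl
      · exact (l.2 _ (cons_mem_boundary (.inl (.inl rfl)))).symm
      · exact (l.2 _ (cons_mem_boundary (.inl (.inr rfl)))).symm

end Divisible

/-! ### Powers of loops -/

section LoopPowers

variable {Y : Type u} [TopologicalSpace Y] {y₀ : Y} {N : ℕ}

theorem continuous_path_wrap (N : ℕ) :
    Continuous fun q : Path y₀ y₀ × I => q.1 (wrap N q.2) :=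
  continuous_comp_wrap (F := fun q : Path y₀ y₀ × I => q.1 q.2) (by fun_prop)
    (fun l => by simp) N

/-- The power map on loops. -/
def pathWrap (N : ℕ) (l : Path y₀ y₀) : Path y₀ y₀ where
  toFun t := l (wrap N t)
  continuous_toFun := (continuous_path_wrap N).comp (by fun_prop : Continuous fun t : I => (l, t))
  source' := by rw [wrap_zero, l.source]
  target' := by rw [wrap_one, l.source]

theorem pathWrap_apply (l : Path y₀ y₀) (t : I) : pathWrap N l t = l (wrap N t) := rfl

theorem continuous_pathWrap (N : ℕ) : Continuous (pathWrap N : Path y₀ y₀ → Path y₀ y₀) :=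
  Path.continuous_uncurry_iff.1 (continuous_path_wrap N)

/-- The base point of the homotopy fibre of the power map on loops. -/
def loopFiberBase (N : ℕ) (y₀ : Y) :
    HoFiber (pathWrap N : Path y₀ y₀ → Path y₀ y₀) (Path.refl y₀) :=
  ⟨⟨(Path.refl y₀, ContinuousMap.const I (Path.refl y₀)), rfl⟩, rfl⟩

theorem continuous_path_of_family {T : Type v} [TopologicalSpace T] {L : T → Path y₀ y₀}
    (h : Continuous fun q : T × I => L q.1 q.2) : Continuous L :=
  Path.continuous_uncurry_iff.1 h

theorem HoFiber.ext_loops {q q' : HoFiber (pathWrap N : Path y₀ y₀ → Path y₀ y₀) (Path.refl y₀)}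
    (h : ∀ t, q.1.1.1 t = q'.1.1.1 t) (h' : ∀ s t, q.1.1.2 s t = q'.1.1.2 s t) : q = q' :=
  Subtype.ext (MapPath.ext (Path.ext (funext h)) fun s => Path.ext (funext (h' s)))

/-- If `N`-th powers are bijective on all homotopy groups, then the homotopy fibre of the `N`-th
power map on the loop space is weakly contractible. -/
theorem nullLoops_loopFiber
    (h : ∀ m, Function.Bijective fun g : HomotopyGroup (Fin (m + 1)) Y y₀ => g ^ N) :
    NullLoops (HoFiber (pathWrap N : Path y₀ y₀ → Path y₀ y₀) (Path.refl y₀))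
      (loopFiberBase N y₀) := by
  intro n l cl hl
  have c1 : Continuous fun x => (l x).1.1.1 :=
    MapPath.continuous_fst.comp (continuous_subtype_val.comp cl)
  have c2 : Continuous fun x => (l x).1.1.2 :=
    MapPath.continuous_snd.comp (continuous_subtype_val.comp cl)
  have b1 : ∀ x ∈ Cube.boundary (Fin n), ∀ t, (l x).1.1.1 t = y₀ := fun x hx t => by
    rw [hl x hx]; rfl
  have b2 : ∀ x ∈ Cube.boundary (Fin n), ∀ s t, (l x).1.1.2 s t = y₀ := fun x hx s t => by
    rw [hl x hx]; rfl
  have e0 : ∀ x, (l x).1.1.2 0 = pathWrap N (l x).1.1.1 := fun x => (l x).1.2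
  have e1 : ∀ x, (l x).1.1.2 1 = Path.refl y₀ := fun x => (l x).2
  let ω : GenLoop (Fin (n + 1)) Y y₀ := ⟨⟨fun x => (l (Fin.tail x)).1.1.1 (x 0), by
      have : Continuous fun x : Fin (n + 1) → I => (l (Fin.tail x)).1.1.1 :=
        c1.comp (by unfold Fin.tail; fun_prop)
      fun_prop⟩, by
    rintro x ⟨j, hj⟩
    change (l (Fin.tail x)).1.1.1 (x 0) = y₀
    cases j using Fin.cases with
    | zero => rcases hj with hj | hj <;> rw [hj] <;> simp
    | succ j => exact b1 _ ⟨j, hj⟩ _⟩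
  have cγ : Continuous fun q : I × (Fin (n + 1) → I) => (l (Fin.tail q.2)).1.1.2 q.1 (q.2 0) := by
    have h1 : Continuous fun q : I × (Fin (n + 1) → I) => (l (Fin.tail q.2)).1.1.2 :=
      c2.comp (by unfold Fin.tail; fun_prop)
    have h2 : Continuous fun q : I × (Fin (n + 1) → I) => (l (Fin.tail q.2)).1.1.2 q.1 := by
      fun_prop
    fun_prop
  let γ : Path (genWrap 0 N ω) (genWrap 0 N GenLoop.const) :=
    { toFun := fun s => ⟨⟨fun x => (l (Fin.tail x)).1.1.2 s (x 0),
          cγ.comp (by fun_prop : Continuous fun x : Fin (n + 1) → I => (s, x))⟩, by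
        rintro x ⟨j, hj⟩
        change (l (Fin.tail x)).1.1.2 s (x 0) = y₀
        cases j using Fin.cases with
        | zero => rcases hj with hj | hj <;> rw [hj] <;> simp
        | succ j => exact b2 _ ⟨j, hj⟩ _ _⟩
      continuous_toFun := continuous_genLoop_of_family cγ
      source' := GenLoop.ext _ _ fun x => by
        change (l (Fin.tail x)).1.1.2 0 (x 0) =
          (l (Fin.tail (Function.update x 0 _))).1.1.1 (Function.update x 0 _ 0)
        rw [e0, Fin.tail_update_zero, Function.update_self, pathWrap_apply]
      target' := GenLoop.ext _ _ fun x => by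
        change (l (Fin.tail x)).1.1.2 1 (x 0) = y₀
        rw [e1]
        rfl }
  obtain ⟨ζ, Γ, cζ, cΓ, ζ0, ζ1, Γ0, Γ1, Γl, Γr⟩ := exists_path_hoFiber (continuous_genWrap 0 N)
    (joined_const_of_pow_injective 0 (h n).1) (exists_loop_of_pow_surjective 0 (h (n + 1)).2) γ
  let Lω : (Fin n → I) × I → Path y₀ y₀ := fun q =>
    { toFun := fun t => ζ q.2 (Fin.cons t q.1)
      continuous_toFun := by fun_prop
      source' := (ζ q.2).2 _ (cons_mem_boundary (.inl (.inl rfl)))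
      target' := (ζ q.2).2 _ (cons_mem_boundary (.inl (.inr rfl))) }
  let LΓ : ((Fin n → I) × I) × I → Path y₀ y₀ := fun q =>
    { toFun := fun t => Γ (q.1.2, q.2) (Fin.cons t q.1.1)
      continuous_toFun := by fun_prop
      source' := (Γ _).2 _ (cons_mem_boundary (.inl (.inl rfl)))
      target' := (Γ _).2 _ (cons_mem_boundary (.inl (.inr rfl))) }
  have cLω : Continuous Lω := continuous_path_of_family (by
    change Continuous fun q : ((Fin n → I) × I) × I => ζ q.1.2 (Fin.cons q.2 q.1.1)
    fun_prop)
  have cLΓ : Continuous LΓ := continuous_path_of_family (by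
    change Continuous fun q : (((Fin n → I) × I) × I) × I =>
      Γ (q.1.1.2, q.1.2) (Fin.cons q.2 q.1.1.1)
    fun_prop)
  obtain ⟨L, cL, hL⟩ := MapPath.exists_family (u := pathWrap N) cLω cLΓ fun q =>
    Path.ext (funext fun t => by
      change Γ (q.2, 0) (Fin.cons t q.1) = ζ q.2 (Fin.cons (wrap N t) q.1)
      rw [Γ0, genWrap_apply, Fin.cons_zero, Fin.update_cons_zero])
  have hend : ∀ q, (L q).endpt = Path.refl y₀ := fun q => by
    refine ((hL q).2 1).trans (Path.ext (funext fun t => ?_))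
    change Γ (q.2, 1) (Fin.cons t q.1) = y₀
    rw [Γ1]
    rfl
  refine ⟨fun q => ⟨L q, hend q⟩, cL.subtype_mk _, fun x => ?_, fun x => ?_, fun x hx t => ?_⟩
  · refine HoFiber.ext_loops (fun t => ?_) fun s t => ?_
    · refine (congrArg (fun l : Path y₀ y₀ => l t) (hL (x, 0)).1).trans ?_
      change ζ 0 (Fin.cons t x) = y₀
      rw [ζ0]
      rfl
    · refine (congrArg (fun l : Path y₀ y₀ => l t) ((hL (x, 0)).2 s)).trans ?_
      change Γ (0, s) (Fin.cons t x) = y₀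
      rw [Γl]
      rfl
  · refine HoFiber.ext_loops (fun t => ?_) fun s t => ?_
    · refine (congrArg (fun l : Path y₀ y₀ => l t) (hL (x, 1)).1).trans ?_
      change ζ 1 (Fin.cons t x) = _
      rw [ζ1]
      rfl
    · refine (congrArg (fun l : Path y₀ y₀ => l t) ((hL (x, 1)).2 s)).trans ?_
      change Γ (1, s) (Fin.cons t x) = _
      rw [Γr]
      rfl
  · refine HoFiber.ext_loops (fun r => ?_) fun s r => ?_
    · refine (congrArg (fun l : Path y₀ y₀ => l r) (hL (x, t)).1).trans ?_
      exact (ζ t).2 _ (cons_mem_boundary (.inr hx))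
    · refine (congrArg (fun l : Path y₀ y₀ => l r) ((hL (x, t)).2 s)).trans ?_
      exact (Γ (t, s)).2 _ (cons_mem_boundary (.inr hx))

theorem joined_refl_of_simplyConnected [SimplyConnectedSpace Y] (l : Path y₀ y₀) :
    Joined (Path.refl y₀) l := by
  obtain ⟨H⟩ := SimplyConnectedSpace.paths_homotopic (Path.refl y₀) l
  refine ⟨⟨⟨fun t => H.eval t, continuous_path_of_family ?_⟩, H.eval_zero, H.eval_one⟩⟩
  exact H.continuous

/-- The path fibration of the power map has the right lifting property for boundaries of cubes. -/
theorem hasRLP_pathWrap [SimplyConnectedSpace Y]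
    (h : ∀ m, Function.Bijective fun g : HomotopyGroup (Fin (m + 1)) Y y₀ => g ^ N) (n : ℕ) :
    HasRLP (MapPath.endpt : MapPath (pathWrap N : Path y₀ y₀ → Path y₀ y₀) → Path y₀ y₀)
      (Cube.boundary (Fin n)) :=
  MapPath.hasRLP _ _ joined_refl_of_simplyConnected (nullLoops_loopFiber h) n

end LoopPowers

/-! ### Lifting of homotopies -/

section PathEnds

variable {E : Type u} [TopologicalSpace E] {B : Type v} [TopologicalSpace B]

theorem HasRLP.of_homeomorph {p : E → B} {T T' : Type} [TopologicalSpace T] [TopologicalSpace T']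
    {S : Set T} (h : T' ≃ₜ T) (hp : HasRLP p (h ⁻¹' S)) : HasRLP p S := by
  intro f ψ hf hψ hc
  obtain ⟨g, cg, hg, gS⟩ := hp (f ∘ h) (ψ ∘ h) (hf.comp h.continuous)
    (hψ.comp h.continuous.continuousOn fun x hx => hx) fun x hx => hc _ hx
  refine ⟨g ∘ h.symm, cg.comp h.symm.continuous, fun x => ?_, fun x hx => ?_⟩
  · simp [hg]
  · have := gS (h.symm x) (by simpa using hx)
    simpa using this

/-- Paths in `B` with lifts of the end points to `E`. -/
def PathEnds (p : E → B) : Type max u v :=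
  {q : (E × E) × C(I, B) // q.2 0 = p q.1.1 ∧ q.2 1 = p q.1.2}

instance (p : E → B) : TopologicalSpace (PathEnds p) :=
  inferInstanceAs (TopologicalSpace {q : (E × E) × C(I, B) // q.2 0 = p q.1.1 ∧ q.2 1 = p q.1.2})

/-- The end points and the projection of a path in `E`. -/
def toPathEnds {p : E → B} (hp : Continuous p) (β : C(I, E)) : PathEnds p :=
  ⟨((β 0, β 1), ContinuousMap.comp ⟨p, hp⟩ β), rfl, rfl⟩

theorem HasRLP.toPathEnds {p : E → B} (hp : Continuous p)
    (h : ∀ n, HasRLP p (Cube.boundary (Fin n))) (n : ℕ) :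
    HasRLP (toPathEnds hp) (Cube.boundary (Fin n)) := by
  classical
  intro f ψ hf hψ hc
  have cf := continuous_subtype_val.comp hf
  have c1 : Continuous fun x => (f x).1.1.1 := cf.fst.fst
  have c2 : Continuous fun x => (f x).1.1.2 := cf.fst.snd
  have c3 : Continuous fun x => (f x).1.2 := cf.snd
  have hS := isClosed_cubeBoundary n
  have p1 : ∀ x ∈ Cube.boundary (Fin n), ψ x 0 = (f x).1.1.1 := fun x hx =>
    congrArg (fun q : PathEnds p => q.1.1.1) (hc x hx)
  have p2 : ∀ x ∈ Cube.boundary (Fin n), ψ x 1 = (f x).1.1.2 := fun x hx =>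
    congrArg (fun q : PathEnds p => q.1.1.2) (hc x hx)
  have p3 : ∀ x ∈ Cube.boundary (Fin n), ∀ t, p (ψ x t) = (f x).1.2 t := fun x hx t =>
    congrArg (fun q : PathEnds p => q.1.2 t) (hc x hx)
  have hprism : HasRLP p (prismBoundary (Cube.boundary (Fin n))) :=
    HasRLP.of_homeomorph (cubeSplit n) (by rw [cubeSplit_preimage]; exact h _)
  let Ψ : (Fin n → I) × I → E := fun z =>
    if z.2 = 0 then (f z.1).1.1.1 else if z.2 = 1 then (f z.1).1.1.2 else ψ z.1 z.2
  have q0 : ∀ x, Ψ (x, 0) = (f x).1.1.1 := fun x => if_pos rfl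
  have q1 : ∀ x, Ψ (x, 1) = (f x).1.1.2 := fun x => by simp [Ψ]
  have q2 : ∀ x ∈ Cube.boundary (Fin n), ∀ t, Ψ (x, t) = ψ x t := fun x hx t => by
    simp only [Ψ]
    split_ifs with h0 h1
    · rw [h0, p1 x hx]
    · rw [h1, p2 x hx]
    · rfl
  have cΨ : ContinuousOn Ψ (prismBoundary (Cube.boundary (Fin n))) := by
    have e : prismBoundary (Cube.boundary (Fin n)) = Prod.fst ⁻¹' Cube.boundary (Fin n) ∪
        ({z | z.2 = 0} ∪ {z | z.2 = 1}) := rfl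
    have k0 : IsClosed {z : (Fin n → I) × I | z.2 = 0} :=
      isClosed_eq continuous_snd continuous_const
    have k1 : IsClosed {z : (Fin n → I) × I | z.2 = 1} :=
      isClosed_eq continuous_snd continuous_const
    rw [e]
    refine ContinuousOn.union_of_isClosed ?_ (ContinuousOn.union_of_isClosed ?_ ?_ k0 k1)
      (hS.preimage continuous_fst) (k0.union k1)
    · have h1 : ContinuousOn (fun z : (Fin n → I) × I => ψ z.1)
          (Prod.fst ⁻¹' Cube.boundary (Fin n)) :=
        hψ.comp continuousOn_fst fun z hz => hz
      have h2 : ContinuousOn (fun z : (Fin n → I) × I => ψ z.1 z.2)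
          (Prod.fst ⁻¹' Cube.boundary (Fin n)) :=
        continuous_eval.comp_continuousOn (h1.prodMk continuousOn_snd)
      exact h2.congr fun z hz => q2 z.1 hz z.2
    · refine (c1.comp continuous_fst).continuousOn.congr fun z hz => ?_
      obtain ⟨x, t⟩ := z
      obtain rfl : t = 0 := hz
      exact q0 x
    · refine (c2.comp continuous_fst).continuousOn.congr fun z hz => ?_
      obtain ⟨x, t⟩ := z
      obtain rfl : t = 1 := hz
      exact q1 x
  obtain ⟨g, cg, hg, gS⟩ := hprism (fun z => (f z.1).1.2 z.2) Ψ (by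
      have := c3.comp (continuous_fst (X := Fin n → I) (Y := I))
      fun_prop) cΨ (by
    rintro ⟨x, t⟩ (hx | hx | hx)
    · rw [q2 x hx, p3 x hx]
    · obtain rfl : t = 0 := hx
      rw [q0]
      exact (f x).2.1.symm
    · obtain rfl : t = 1 := hx
      rw [q1]
      exact (f x).2.2.symm)
  refine ⟨ContinuousMap.curry ⟨g, cg⟩, (ContinuousMap.curry ⟨g, cg⟩).continuous, fun x => ?_,
    fun x hx => ?_⟩
  · refine Subtype.ext (Prod.ext (Prod.ext ?_ ?_) (ContinuousMap.ext fun t => ?_))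
    · exact (gS (x, 0) (.inr (.inl rfl))).trans (q0 x)
    · exact (gS (x, 1) (.inr (.inr rfl))).trans (q1 x)
    · exact hg (x, t)
  · exact ContinuousMap.ext fun t => (gS (x, t) (.inl hx)).trans (q2 x hx t)

end PathEnds

/-! ### Division of maps into a loop space -/

section LoopSpace

variable {Y : Type u} [TopologicalSpace Y] [Based Y]

instance : Based (Path (Based.pt : Y) Based.pt) := ⟨Path.refl _⟩

/-- The power map on the loop space, as a pointed map. -/
def loopPower (Y : Type u) [TopologicalSpace Y] [Based Y] (N : ℕ) :
    PMap (Path (Based.pt : Y) Based.pt) (Path (Based.pt : Y) Based.pt) :=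
  ⟨⟨pathWrap N, continuous_pathWrap N⟩, rfl⟩

variable {N : ℕ} [SimplyConnectedSpace Y]

theorem exists_loopPower_comp_homotopic
    (hN : ∀ m, Function.Bijective fun g : HomotopyGroup (Fin (m + 1)) Y Based.pt => g ^ N)
    {K : Type v} [TopologicalSpace K] [Based K] [T2Space K]
    [Topology.RelCWComplex (Set.univ : Set K) {(Based.pt : K)}]
    (f : PMap K (Path (Based.pt : Y) Based.pt)) :
    ∃ g, ((loopPower Y N).comp g).Homotopic f := by
  obtain ⟨q, cq, hq, hq0⟩ := exists_lift_of_hasRLP (K := K) (hasRLP_pathWrap hN)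
    f.toMap.continuous (e₀ := (loopFiberBase N Based.pt).1) f.map_pt.symm
  have c1 : Continuous fun x => (q x).1.1 := MapPath.continuous_fst.comp cq
  have c2 : Continuous fun x => (q x).1.2 := MapPath.continuous_snd.comp cq
  refine ⟨⟨⟨fun x => (q x).1.1, c1⟩, by dsimp only [ContinuousMap.coe_mk]; rw [hq0]; rfl⟩,
    PMap.homotopic_of_family _ _ (fun s x => (q x).1.2 s) (by fun_prop) (fun x => (q x).2) hq
      fun s => congrArg (fun z : MapPath _ => z.1.2 s) hq0⟩

theorem homotopic_of_loopPower_comp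
    (hN : ∀ m, Function.Bijective fun g : HomotopyGroup (Fin (m + 1)) Y Based.pt => g ^ N)
    {K : Type v} [TopologicalSpace K] [Based K] [T2Space K]
    [Topology.RelCWComplex (Set.univ : Set K) {(Based.pt : K)}]
    {f g : PMap K (Path (Based.pt : Y) Based.pt)}
    (h : ((loopPower Y N).comp f).Homotopic ((loopPower Y N).comp g)) : f.Homotopic g := by
  obtain ⟨H, cH, H0, H1, Hp⟩ := h.family
  have cc : Continuous fun l : Path (Based.pt : Y) Based.pt =>
      (⟨(l, ContinuousMap.const I (pathWrap N l)), rfl⟩ : MapPath (pathWrap N)) :=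
    Continuous.subtype_mk (continuous_id.prodMk
      (ContinuousMap.continuous_const'.comp (continuous_pathWrap N))) _
  let F : K → PathEnds (MapPath.endpt :
      MapPath (pathWrap N : Path (Based.pt : Y) Based.pt → _) → Path (Based.pt : Y) Based.pt) :=
    fun x => ⟨((⟨(f.toMap x, ContinuousMap.const I (pathWrap N (f.toMap x))), rfl⟩,
      ⟨(g.toMap x, ContinuousMap.const I (pathWrap N (g.toMap x))), rfl⟩),
      ContinuousMap.curry ⟨fun q : K × I => H q.2 q.1, cH.comp continuous_swap⟩ x),
      H0 x, H1 x⟩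
  have cF : Continuous F := Continuous.subtype_mk
    (((cc.comp f.toMap.continuous).prodMk (cc.comp g.toMap.continuous)).prodMk
      (ContinuousMap.curry ⟨fun q : K × I => H q.2 q.1, cH.comp continuous_swap⟩).continuous) _
  obtain ⟨L, cL, hL, hL0⟩ := exists_lift_of_hasRLP (K := K)
    (HasRLP.toPathEnds MapPath.continuous_endpt (hasRLP_pathWrap hN)) cF
    (e₀ := ContinuousMap.const I (loopFiberBase N Based.pt).1) (by
      refine Subtype.ext (Prod.ext (Prod.ext ?_ ?_) (ContinuousMap.ext fun t => (Hp t).symm))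
      · change (_ : MapPath _) = ⟨(f.toMap _, _), _⟩
        refine MapPath.ext f.map_pt.symm fun t => ?_
        change _ = pathWrap N (f.toMap Based.pt)
        rw [f.map_pt]
        rfl
      · change (_ : MapPath _) = ⟨(g.toMap _, _), _⟩
        refine MapPath.ext g.map_pt.symm fun t => ?_
        change _ = pathWrap N (g.toMap Based.pt)
        rw [g.map_pt]
        rfl)
  refine PMap.homotopic_of_family _ _ (fun t x => (L x t).1.1) ?_ (fun x => ?_) (fun x => ?_)
    fun t => ?_
  · exact MapPath.continuous_fst.comp (by fun_prop : Continuous fun q : I × K => L q.2 q.1)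
  · exact congrArg (fun q : PathEnds _ => q.1.1.1.1.1) (hL x)
  · exact congrArg (fun q : PathEnds _ => q.1.1.2.1.1) (hL x)
  · exact congrArg (fun l : C(I, MapPath _) => (l t).1.1) hL0

variable {A : Type v} [TopologicalSpace A] [Based A]

theorem HasPointedCWType.exists_loopPower_comp_homotopic (hA : HasPointedCWType A)
    (hN : ∀ m, Function.Bijective fun g : HomotopyGroup (Fin (m + 1)) Y Based.pt => g ^ N)
    (f : PMap A (Path (Based.pt : Y) Based.pt)) :
    ∃ g, ((loopPower Y N).comp g).Homotopic f := by
  obtain ⟨K, _, _, _, _, i, r, hri, -⟩ := hA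
  obtain ⟨g, hg⟩ := LabelTrace.exists_loopPower_comp_homotopic hN (f.comp r)
  exact ⟨g.comp i, (PMap.comp_homotopic hg (.refl i.toMap)).trans
    (PMap.comp_homotopic (.refl f.toMap) hri)⟩

theorem HasPointedCWType.homotopic_of_loopPower_comp (hA : HasPointedCWType A)
    (hN : ∀ m, Function.Bijective fun g : HomotopyGroup (Fin (m + 1)) Y Based.pt => g ^ N)
    {f g : PMap A (Path (Based.pt : Y) Based.pt)}
    (h : ((loopPower Y N).comp f).Homotopic ((loopPower Y N).comp g)) : f.Homotopic g := by
  obtain ⟨K, _, _, _, _, i, r, hri, -⟩ := hA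
  have h0 : (((loopPower Y N).comp f).comp r).Homotopic (((loopPower Y N).comp g).comp r) :=
    PMap.comp_homotopic h (.refl r.toMap)
  have h1 : (f.comp r).Homotopic (g.comp r) := LabelTrace.homotopic_of_loopPower_comp hN h0
  have h2 : ∀ f : PMap A (Path (Based.pt : Y) Based.pt), ((f.comp r).comp i).Homotopic f :=
    fun f => PMap.comp_homotopic (.refl f.toMap) hri
  exact ((h2 f).symm.trans (PMap.comp_homotopic h1 (.refl i.toMap))).trans (h2 g)

end LoopSpace

/-! ### The adjunction between suspension and loop space -/

section Adjunction

variable {A : Type u} [TopologicalSpace A] [Based A] {Y : Type v} [TopologicalSpace Y] [Based Y]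

/-- The map `A → ΩY` adjoint to a map `ΣA → Y`. -/
def PMap.toLoop (f : PMap (Susp A) Y) : PMap A (Path (Based.pt : Y) Based.pt) where
  toMap := ⟨fun a =>
      { toFun := fun t => f.toMap (Susp.mk a t)
        continuous_toFun := f.toMap.continuous.comp
          (Susp.continuous_mk.comp (by fun_prop : Continuous fun t : I => (a, t)))
        source' := f.map_susp_pt (.inr (.inl rfl))
        target' := f.map_susp_pt (.inr (.inr rfl)) },
    continuous_path_of_family (f.toMap.continuous.comp Susp.continuous_mk)⟩
  map_pt := Path.ext (funext fun _ => f.map_susp_pt (.inl rfl))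

/-- The map `ΣA → Y` adjoint to a map `A → ΩY`. -/
def PMap.fromLoop (g : PMap A (Path (Based.pt : Y) Based.pt)) : PMap (Susp A) Y :=
  PMap.ofSusp (fun a t => g.toMap a t) (by fun_prop) (by
    rintro a t (rfl | rfl | rfl)
    · rw [g.map_pt]; rfl
    · simp
    · simp)

theorem PMap.fromLoop_toLoop (f : PMap (Susp A) Y) : f.toLoop.fromLoop = f :=
  PMap.ext_susp fun _ _ => rfl

theorem PMap.toLoop_fromLoop (g : PMap A (Path (Based.pt : Y) Based.pt)) :
    g.fromLoop.toLoop = g :=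
  PMap.ext_apply fun _ => Path.ext rfl

theorem PMap.toLoop_comp_suspWrap (f : PMap (Susp A) Y) (N : ℕ) :
    (f.comp (suspWrap A N)).toLoop = (loopPower Y N).comp f.toLoop :=
  PMap.ext_apply fun _ => Path.ext rfl

theorem PMap.Homotopic.toLoop {f g : PMap (Susp A) Y} (h : f.Homotopic g) :
    f.toLoop.Homotopic g.toLoop := by
  obtain ⟨H, cH, H0, H1, Hp⟩ := h.family
  have hp : ∀ s a t, (a = Based.pt ∨ t = 0 ∨ t = 1) → H s (Susp.mk a t) = Based.pt :=
    fun s a t h => by rw [Susp.mk_eq_pt.2 h, Hp]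
  have cL : Continuous fun q : (I × A) × I => H q.1.1 (Susp.mk q.1.2 q.2) :=
    cH.comp ((by fun_prop : Continuous fun q : (I × A) × I => q.1.1).prodMk
      (Susp.continuous_mk.comp (by fun_prop : Continuous fun q : (I × A) × I => (q.1.2, q.2))))
  let L : I × A → Path (Based.pt : Y) Based.pt := fun q =>
    { toFun := fun t => H q.1 (Susp.mk q.2 t)
      continuous_toFun := cL.comp (by fun_prop : Continuous fun t : I => (q, t))
      source' := hp _ _ _ (.inr (.inl rfl))
      target' := hp _ _ _ (.inr (.inr rfl)) }
  refine PMap.homotopic_of_family _ _ (fun s a => L (s, a)) (continuous_path_of_family cL)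
    (fun a => Path.ext (funext fun t => H0 _)) (fun a => Path.ext (funext fun t => H1 _))
    fun s => Path.ext (funext fun t => hp _ _ _ (.inl rfl))

theorem PMap.Homotopic.fromLoop {f g : PMap A (Path (Based.pt : Y) Based.pt)}
    (h : f.Homotopic g) : f.fromLoop.Homotopic g.fromLoop := by
  obtain ⟨H, cH, H0, H1, Hp⟩ := h.family
  have c : ∀ s, Continuous (H s) := fun s =>
    cH.comp (by fun_prop : Continuous fun a : A => (s, a))
  let G : I → PMap (Susp A) Y := fun s => PMap.fromLoop ⟨⟨H s, c s⟩, Hp s⟩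
  refine PMap.homotopic_of_family _ _ (fun s => (G s).toMap)
    (Susp.continuous_param (fun s => (G s).toMap) ?_) (Susp.ind fun a t => ?_)
    (Susp.ind fun a t => ?_) fun s => (G s).map_pt
  · change Continuous fun q : I × (A × I) => H q.1 q.2.1 q.2.2
    have : Continuous fun q : I × (A × I) => H q.1 q.2.1 :=
      cH.comp (by fun_prop : Continuous fun q : I × (A × I) => (q.1, q.2.1))
    fun_prop
  · exact congrArg (fun l : Path (Based.pt : Y) Based.pt => l t) (H0 a)
  · exact congrArg (fun l : Path (Based.pt : Y) Based.pt => l t) (H1 a)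

/-- If `N`-th powers are bijective on the homotopy groups of `ΣA`, then the self map of degree `N`
of `ΣA` is a homotopy equivalence. -/
theorem exists_inverse_suspWrap [SimplyConnectedSpace (Susp A)] (hA : HasPointedCWType A) {N : ℕ}
    (hN : ∀ m, Function.Bijective
      fun g : HomotopyGroup (Fin (m + 1)) (Susp A) Based.pt => g ^ N) :
    ∃ g : PMap (Susp A) (Susp A), (g.comp (suspWrap A N)).Homotopic (PMap.id _) ∧
      ((suspWrap A N).comp g).Homotopic (PMap.id _) := by
  obtain ⟨γ, hγ⟩ := hA.exists_loopPower_comp_homotopic hN (PMap.id (Susp A)).toLoop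
  have hl : (γ.fromLoop.comp (suspWrap A N)).Homotopic (PMap.id _) := by
    rw [← PMap.toLoop_fromLoop γ, ← PMap.toLoop_comp_suspWrap] at hγ
    have := hγ.fromLoop
    rwa [PMap.fromLoop_toLoop, PMap.fromLoop_toLoop] at this
  refine ⟨γ.fromLoop, hl, ?_⟩
  have h : ((loopPower _ N).comp ((suspWrap A N).comp γ.fromLoop).toLoop).Homotopic
      ((loopPower _ N).comp (PMap.id (Susp A)).toLoop) := by
    rw [← PMap.toLoop_comp_suspWrap, ← PMap.toLoop_comp_suspWrap]
    have h' : ((suspWrap A N).comp (γ.fromLoop.comp (suspWrap A N))).Homotopic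
        ((suspWrap A N).comp (PMap.id _)) := PMap.comp_homotopic (.refl (suspWrap A N).toMap) hl
    exact h'.toLoop
  have := (hA.homotopic_of_loopPower_comp hN h).fromLoop
  rwa [PMap.fromLoop_toLoop, PMap.fromLoop_toLoop] at this

end Adjunction

section PLocal

variable {p : ℕ}

theorem IsPLocal.pow_bijective {X : Type u} [TopologicalSpace X] [Based X] (hX : IsPLocal p X)
    {N : ℕ} (hN : ¬ p ∣ N) (m : ℕ) :
    Function.Bijective fun g : HomotopyGroup (Fin (m + 1)) X Based.pt => g ^ N := by
  induction N using induction_on_primes with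
  | zero => exact absurd (dvd_zero p) hN
  | one => simpa only [pow_one] using! Function.bijective_id
  | prime_mul q N hq ih =>
    have h1 := hX.2 m q hq fun h => hN (h ▸ dvd_mul_right q N)
    have h2 := (ih fun h => hN (h.mul_left q)).comp h1
    simp only [pow_mul]
    exact h2

/-- If `ΣA` is `p`-local, then `[(ΣA)^{(n)}, W]` is uniquely divisible by the integers prime
to `p`. -/
theorem IsPLocal.nsmul_bijective {n : ℕ} [NeZero n] {A : Type u} [TopologicalSpace A] [Based A]
    [T1Space A] (hA : HasPointedCWType A) (hX : IsPLocal p (Susp A)) {W : Type v}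
    [TopologicalSpace W] [Based W] {N : ℕ} (hN : ¬ p ∣ N) :
    Function.Bijective fun c : HClass (Smash n (Susp A)) W => N • c := by
  have := hX.1
  obtain ⟨g, hl, hr⟩ := exists_inverse_suspWrap hA (hX.pow_bijective hN)
  exact HClass.nsmul_bijective g hl hr

end PLocal

end LabelTrace

end
theorem proposition4p4 (p : ℕ) [Fact p.Prime] (n : ℕ) [NeZero n]
    (A : Type*) [TopologicalSpace A] [LabelTrace.Based A] [T1Space A]
    (hA : LabelTrace.HasPointedCWType A) (hX : LabelTrace.IsPLocal p (LabelTrace.Susp A))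
    (M : LabelTrace.FunctorialRetract (LabelTrace.ZLoc p) n) (hM : M.IsSmallest) :
    (∃ e, M.IsInducedBy e) ∧ ∀ e, M.IsInducedBy e →
      (∃! c : LabelTrace.HClass (LabelTrace.Smash n (LabelTrace.Susp A))
        (LabelTrace.Smash n (LabelTrace.Susp A)), LabelTrace.Represents p e c) ∧
      ∀ a : LabelTrace.PMap (LabelTrace.Smash n (LabelTrace.Susp A))
        (LabelTrace.Smash n (LabelTrace.Susp A)), LabelTrace.Represents p e a.cls →
        ∃ b : LabelTrace.PMap (LabelTrace.Hocolim a) (LabelTrace.Smash n (LabelTrace.Susp A)),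
          (b.comp (LabelTrace.Hocolim.incl a)).cls = LabelTrace.traceClass n A := by
  have hdiv : ∀ N : ℕ, ¬ p ∣ N → Function.Bijective
      fun c : LabelTrace.HClass (LabelTrace.Smash n (LabelTrace.Susp A))
        (LabelTrace.Smash n (LabelTrace.Susp A)) => N • c := fun N hN =>
    hX.nsmul_bijective hA hN
  refine ⟨M.exists_isInducedBy, fun e he =>
    ⟨LabelTrace.existsUnique_represents hdiv e, fun a ha => ?_⟩⟩
  obtain ⟨φ, hφ⟩ := Quotient.exists_rep (LabelTrace.traceClass n A)
  have h := LabelTrace.trace_comp_eq hdiv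
    (LabelTrace.FunctorialRetract.sum_coeff_eq_one hM.1 he) ha hφ
  have h' : (φ.comp a).Homotopic φ := Quotient.exact h
  obtain ⟨b, hb⟩ := LabelTrace.exists_factor_hocolim a φ h'.symm
  exact ⟨b, by rw [hb]; exact hφ⟩
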